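/- Let $\mathcal A\subset\mathbb R^p$ be a compact set with $0\in\mathrm{conv}(\mathcal A)$, and let $$\|x\|_{\mathcal A}=\inf\{t>0: x\in t\,\mathrm{conv}(\mathcal A)\}\in[0,\infty]$$ be its gauge (the atomic norm). Let $x^\star\neq 0$ be a finite combination of elements of $\mathcal A$ with nonnegative coefficients, let $T_{\mathcal A}(x^\star)=\mathrm{cone}\{z-x^\star:\|z\|_{\mathcal A}\le\|x^\star\|_{\mathcal A}\}$ be the tangent cone at $x^\star$, and let $\Omega=T_{\mathcal A}(x^\star)\cap\mathbb S^{p-1}$. Write $w(\Omega)=\mathbb E_g\left[\sup_{z\in\Omega} g^Tz\right]$, with $g\sim\mathcal N(0,I_p)$, for the Gaussian width of $\Omega$, and $\lambda_n$ for the expected Euclidean length of a standard Gaussian vector in $\mathbb R^n$. Let $\Phi:\mathbb R^p\to\mathbb R^n$ be a random linear map whose matrix has independent Gaussian entries with mean $0$ and variance $1/n$; $\|\cdot\|$ denotes the Euclidean norm. 1. If $n\ge w(\Omega)^2+1$, then with probability at least $1-\exp\left(-\tfrac12\left[\lambda_n-w(\Omega)\right]^2\right)$ the vector $x^\star$ is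 the unique optimal solution of $$\min_x\|x\|_{\mathcal A}\quad\text{subject to}\quad \Phi x=\Phi x^\star .$$ 2. Let $0<\epsilon<1$ and $\delta\in\mathbb R$. If $n\ge\dfrac{w(\Omega)^2+3/2}{(1-\epsilon)^2}$, then with probability at least $1-\exp\left(-\tfrac12\left[\lambda_n-w(\Omega)-\sqrt n\,\epsilon\right]^2\right)$ the following holds for every noise vector $\omega\in\mathbb R^n$ with $\|\omega\|\le\delta$: with $y=\Phi x^\star+\omega$, the program $$\min_x\|x\|_{\mathcal A}\quad\text{subject to}\quad \|y-\Phi x\|\le\delta$$ has an optimal solution, and every optimal solution $\hat x$ of it satisfies $\|x^\star-\hat x\|\le 2\delta/\epsilon$. -/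

import Mathlib

open MeasureTheory ProbabilityTheory
open scoped ENNReal NNReal Pointwise

noncomputable section

/-- The gauge (atomic norm) `inf {t > 0 : x ∈ t conv(A)}` of a set of atoms `A`, with values in
`[0, ∞]`; it equals `∞` when no such `t` exists. -/
def atomicNorm {p : ℕ} (A : Set (EuclideanSpace ℝ (Fin p))) (x : EuclideanSpace ℝ (Fin p)) :
    ℝ≥0∞ :=
  ⨅ (t : ℝ) (_ : 0 < t ∧ x ∈ t • convexHull ℝ A), ENNReal.ofReal t

/-- `x` is a (finite) combination of atoms with nonnegative coefficients. -/
def IsAtomicCombination {p : ℕ} (A : Set (EuclideanSpace ℝ (Fin p)))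
    (x : EuclideanSpace ℝ (Fin p)) : Prop :=
  ∃ (k : ℕ) (c : Fin k → ℝ) (a : Fin k → EuclideanSpace ℝ (Fin p)),
    (∀ i, 0 ≤ c i) ∧ (∀ i, a i ∈ A) ∧ x = ∑ i, c i • a i

/-- The tangent cone `cone {z - x : ‖z‖_A ≤ ‖x‖_A}`. The generating set contains `0` (take
`z = x`), so it does not matter whether conic hulls are required to contain `0`. -/
def tangentCone {p : ℕ} (A : Set (EuclideanSpace ℝ (Fin p)))
    (x : EuclideanSpace ℝ (Fin p)) : Set (EuclideanSpace ℝ (Fin p)) :=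
  (ConvexCone.hull ℝ {d | ∃ z, atomicNorm A z ≤ atomicNorm A x ∧ d = z - x} :
    ConvexCone ℝ (EuclideanSpace ℝ (Fin p)))

/-- The spherical part of the tangent cone. -/
def sphericalPart {p : ℕ} (A : Set (EuclideanSpace ℝ (Fin p)))
    (x : EuclideanSpace ℝ (Fin p)) : Set (EuclideanSpace ℝ (Fin p)) :=
  tangentCone A x ∩ Metric.sphere 0 1

/-- The Gaussian width `E_g [sup_{z ∈ S} gᵀ z]`, where `g` is a standard Gaussian vector. -/
def gaussianWidth {p : ℕ} (S : Set (EuclideanSpace ℝ (Fin p))) : ℝ :=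
  ∫ g, (⨆ z : S, inner ℝ g (z : EuclideanSpace ℝ (Fin p)))
    ∂(stdGaussian (EuclideanSpace ℝ (Fin p)))

/-- The expected length of a `k`-dimensional standard Gaussian vector. -/
def gaussianLength (k : ℕ) : ℝ :=
  ∫ g, ‖g‖ ∂(stdGaussian (EuclideanSpace ℝ (Fin k)))

/-- The entries of the random matrix `Φ` are independent, each with law `N(0, 1/n)`. -/
structure IsGaussianMap {Ω : Type*} [MeasurableSpace Ω] (P : Measure Ω) {n p : ℕ}
    (Φ : Ω → Matrix (Fin n) (Fin p) ℝ) : Prop where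
  law : ∀ i j, HasLaw (fun ω => Φ ω i j) (gaussianReal 0 ((n : ℝ≥0)⁻¹)) P
  indep : iIndepFun (fun (ij : Fin n × Fin p) ω => Φ ω ij.1 ij.2) P

/-- `x` minimises the atomic norm over the feasible set `F`. -/
def IsAtomicMinimizer {p : ℕ} (A F : Set (EuclideanSpace ℝ (Fin p)))
    (x : EuclideanSpace ℝ (Fin p)) : Prop :=
  x ∈ F ∧ ∀ x' ∈ F, atomicNorm A x ≤ atomicNorm A x'

/-- `x` is an optimal solution of: minimise `‖x‖_A` subject to `y = M x`. -/
def SolvesExact {n p : ℕ} (A : Set (EuclideanSpace ℝ (Fin p))) (M : Matrix (Fin n) (Fin p) ℝ)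
    (y : EuclideanSpace ℝ (Fin n)) (x : EuclideanSpace ℝ (Fin p)) : Prop :=
  IsAtomicMinimizer A {x | y = Matrix.toEuclideanLin M x} x

/-- `x` is an optimal solution of: minimise `‖x‖_A` subject to `‖y - M x‖ ≤ δ`. -/
def SolvesNoisy {n p : ℕ} (A : Set (EuclideanSpace ℝ (Fin p))) (M : Matrix (Fin n) (Fin p) ℝ)
    (y : EuclideanSpace ℝ (Fin n)) (δ : ℝ) (x : EuclideanSpace ℝ (Fin p)) : Prop :=
  IsAtomicMinimizer A {x | ‖y - Matrix.toEuclideanLin M x‖ ≤ δ} x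

/-- The property `G` holds with probability at least `q`. As `G` is not assumed measurable, this is
stated as: `G` holds throughout some measurable event of probability at least `q`. -/
def HoldsWithProbAtLeast {Ω : Type*} [MeasurableSpace Ω] (P : Measure Ω) (q : ℝ)
    (G : Ω → Prop) : Prop :=
  ∃ E : Set Ω, MeasurableSet E ∧ (∀ ω ∈ E, G ω) ∧ q ≤ P.real E

end

/-!
If the random map `Φ` has gain at least `ε > 0` on the spherical part `S` of the tangent cone at
`x⋆`, then `ε ‖z - x⋆‖ ≤ ‖Φ z - Φ x⋆‖` whenever `‖z‖_A ≤ ‖x⋆‖_A` (`mul_norm_sub_le`). This gives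
uniqueness in the noiseless program and, by the triangle inequality, the error bound `2 δ / ε` in
the noisy one. Optimal solutions exist because `conv A` is compact: the sublevel sets of the atomic
norm are the sets `t • conv A`, so the atomic norm is lower semicontinuous and may be minimised
over a compact set.

The probabilistic content is Gordon's escape theorem `exists_forall_le_norm_matVec`: for a standard
Gaussian matrix `G` one has `‖G z‖ ≥ c` on `S` with probability at least
`1 - exp (-(λₙ - w(S) - c)² / 2)`. It follows from Chernoff's bound and
`E exp (-s min_z ‖G z‖) ≤ exp (s² / 2 - s (λₙ - w(S)))`, over finite subsets of `S`, proved in two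
steps, each of them an instance of one comparison principle.

* **Comparison** (`SmoothAlongLines.integral_exp_le_of_comparison`). If at every point the
  second-order effect `∫ (f'' + f'²)` of an infinitesimal Gaussian step of law `μ` on `exp f`
  exceeds that of `ν` by at most `κ`, then `∫ exp f dμ ≤ exp (κ / 2) ∫ exp f dν`. The Gaussian steps
  are exchanged one after the other, as in Lindeberg's proof of the central limit theorem.
* **Gordon's step** (`integral_exp_smoothMax_gordonFun_le`). Let `f` be `s` times a smooth version
  of `max_z (-‖G z + h‖ + ⟨z, g⟩)`, with Gaussian vectors `g` and `h`. Exchanging `(h, g)` for `G`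
  changes the second-order effect by a negative multiple of
  `∑ p_z p_z' (1 - ⟨u_z, u_z'⟩) (1 - ⟨z, z'⟩) ≥ 0`, where `p` are the Gibbs weights of the smooth
  maximum and `u_z` the normalised vectors `G z + h`, up to a constant `-s²`. So the comparison even
  gains a factor `exp (-s² / 2)`.
* **Concentration** (`SmoothAlongLines.integral_exp_le_exp_integral`). The comparison of the
  diagonal law of `(Y, Y)` with that of two independent copies, applied to `(f(y₁) + f(y₂)) / 2`,
  gives `E exp f ≤ exp (κ / 4) (E exp (f / 2))²` when `E f'² ≤ κ`. Iterated, it yields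
  `E exp f ≤ exp (κ / 2 + E f)`. As a function of `(h, g)`, the `f` of Gordon's step has
  `κ = 2 s²`, a cost of `exp (s²)`; together with the gain above this leaves `exp (s² / 2)`.

Concentration of `‖h‖` itself shows that its variance is at most `1`, that is `λₙ² ≥ n - 1`
(`sub_one_le_gaussianLength_sq`). This turns the two hypotheses on `n` into `λₙ ≥ w` and
`λₙ ≥ w + √n ε`. In the first case the event of unique recovery contains, for all small `ε > 0`,
the event of gain at least `ε`, and `ε → 0` gives the probability.
-/

set_option linter.unusedSectionVars false

/-! ### Centred Gaussian measures on Banach spaces -/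

section CenteredGaussian

variable {V : Type*} [NormedAddCommGroup V] [NormedSpace ℝ V] [CompleteSpace V]
  [SecondCountableTopology V] [MeasurableSpace V] [BorelSpace V]

theorem integrable_exp_mul_norm (μ : Measure V) [IsGaussian μ] (c : ℝ) :
    Integrable (fun x => Real.exp (c * ‖x‖)) μ := by
  obtain ⟨C, hC, h⟩ := IsGaussian.exists_integrable_exp_sq μ
  refine (h.const_mul (Real.exp (c ^ 2 / (4 * C)))).mono' (by fun_prop) (ae_of_all _ fun x => ?_)
  rw [Real.norm_of_nonneg (Real.exp_pos _).le, ← Real.exp_add]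
  refine Real.exp_le_exp.2 ?_
  have h1 : c ^ 2 / (4 * C) + C * ‖x‖ ^ 2 - c * ‖x‖ = (c / 2 - C * ‖x‖) ^ 2 / C := by
    field_simp
    ring
  have h2 : 0 ≤ (c / 2 - C * ‖x‖) ^ 2 / C := by positivity
  linarith

theorem integrable_of_abs_le_exp (μ : Measure V) [IsGaussian μ] {g : V → ℝ} (hg : Continuous g)
    (K c : ℝ) (h : ∀ x, |g x| ≤ K * Real.exp (c * ‖x‖)) : Integrable g μ :=
  ((integrable_exp_mul_norm μ c).const_mul K).mono' hg.measurable.aestronglyMeasurable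
    (ae_of_all _ h)

/-- The law of `√t • X` when `X` has law `μ`: the time-`t` marginal of the Gaussian semigroup
generated by `μ`. -/
noncomputable def gaussianScale (μ : Measure V) (t : ℝ) : Measure V :=
  μ.map (fun x => √t • x)

instance (μ : Measure V) [IsGaussian μ] (t : ℝ) : IsGaussian (gaussianScale μ t) :=
  inferInstanceAs (IsGaussian (μ.map (√t • ContinuousLinearMap.id ℝ V)))

theorem gaussianScale_one (μ : Measure V) : gaussianScale μ 1 = μ := by
  simp [gaussianScale]

theorem gaussianScale_zero (μ : Measure V) [IsProbabilityMeasure μ] :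
    gaussianScale μ 0 = Measure.dirac 0 := by
  simp [gaussianScale, Measure.map_const]

theorem integral_gaussianScale (μ : Measure V) (t : ℝ) {g : V → ℝ} (hg : Continuous g) :
    ∫ x, g x ∂(gaussianScale μ t) = ∫ x, g (√t • x) ∂μ :=
  integral_map (by fun_prop) hg.measurable.aestronglyMeasurable

theorem charFunDual_gaussianScale {μ : Measure V} [IsGaussian μ] (hμ : μ[id] = 0) {t : ℝ}
    (ht : 0 ≤ t) (L : StrongDual ℝ V) :
    charFunDual (gaussianScale μ t) L = Complex.exp (-(t * Var[L; μ] : ℝ) / 2) := by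
  have h : gaussianScale μ t = μ.map (√t • ContinuousLinearMap.id ℝ V) := rfl
  rw [h, charFunDual_map, IsGaussian.charFunDual_eq_of_integral_eq_zero hμ]
  have h2 : ⇑(L.comp (√t • ContinuousLinearMap.id ℝ V)) = fun x => √t * L x := by
    ext x; simp
  rw [h2, variance_const_mul, Real.sq_sqrt ht]

/-- Stability of centred Gaussian laws, as a semigroup property. -/
theorem gaussianScale_conv {μ : Measure V} [IsGaussian μ] (hμ : μ[id] = 0) {s t : ℝ}
    (hs : 0 ≤ s) (ht : 0 ≤ t) :
    gaussianScale μ s ∗ gaussianScale μ t = gaussianScale μ (s + t) := by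
  refine Measure.ext_of_charFunDual ?_
  ext L
  rw [charFunDual_conv, charFunDual_gaussianScale hμ hs,
    charFunDual_gaussianScale hμ ht, charFunDual_gaussianScale hμ (add_nonneg hs ht),
    ← Complex.exp_add]
  congr 1
  push_cast
  ring

theorem map_neg_eq_self {μ : Measure V} [IsGaussian μ] (hμ : μ[id] = 0) :
    μ.map (fun x => -x) = μ := by
  have h : μ.map (fun x => -x) = μ.map (-ContinuousLinearMap.id ℝ V) := rfl
  rw [h]
  refine Measure.ext_of_charFunDual ?_
  ext L
  rw [charFunDual_map, IsGaussian.charFunDual_eq_of_integral_eq_zero hμ,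
    IsGaussian.charFunDual_eq_of_integral_eq_zero hμ]
  have h2 : ⇑(L.comp (-ContinuousLinearMap.id ℝ V)) = fun x => -1 * L x := by
    ext x; simp
  rw [h2, variance_const_mul]
  norm_num

theorem integral_comp_neg {μ : Measure V} [IsGaussian μ] (hμ : μ[id] = 0) {g : V → ℝ}
    (hg : Continuous g) : ∫ x, g (-x) ∂μ = ∫ x, g x ∂μ := by
  conv_rhs => rw [← map_neg_eq_self hμ]
  rw [integral_map (by fun_prop) hg.measurable.aestronglyMeasurable]

/-- In particular, the first-order term of a Gaussian step has mean zero. -/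
theorem integral_eq_zero_of_odd {μ : Measure V} [IsGaussian μ] (hμ : μ[id] = 0) {g : V → ℝ}
    (hg : Continuous g) (hodd : ∀ x, g (-x) = -g x) : ∫ x, g x ∂μ = 0 := by
  have h := integral_comp_neg hμ hg
  simp only [hodd, integral_neg] at h
  linarith

theorem integral_conv_real (μ ν : Measure V) [IsProbabilityMeasure μ] [IsProbabilityMeasure ν]
    {g : V → ℝ} (hg : Continuous g) (hi : Integrable g (μ ∗ ν)) :
    ∫ x, g x ∂(μ ∗ ν) = ∫ x, ∫ y, g (x + y) ∂ν ∂μ := by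
  rw [Measure.conv, integral_map (by fun_prop) hg.measurable.aestronglyMeasurable]
  rw [integral_prod]
  exact (integrable_map_measure hg.measurable.aestronglyMeasurable (by fun_prop)).1 hi

end CenteredGaussian

/-! ### Functions with bounded directional derivatives -/

section SmoothAlongLines

variable {V : Type*} [NormedAddCommGroup V] [NormedSpace ℝ V]

/-- `f` is three times differentiable along every line, with directional derivatives
`d1 x v`, `d2 x v`, `d3 x v` at `x` in the direction `v` that are bounded, uniformly in `x`, by
`C * ‖v‖`, `C * ‖v‖ ^ 2` and `C * ‖v‖ ^ 3`. Continuity of `d1 x` and `d2 x` in the direction makes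
them measurable; their homogeneity (`d1_smul`, `d2_smul`) is automatic. -/
structure SmoothAlongLines (f : V → ℝ) (d1 d2 d3 : V → V → ℝ) (C : ℝ) : Prop where
  nonneg : 0 ≤ C
  deriv1 : ∀ x v t, HasDerivAt (fun t : ℝ => f (x + t • v)) (d1 (x + t • v) v) t
  deriv2 : ∀ x v t, HasDerivAt (fun t : ℝ => d1 (x + t • v) v) (d2 (x + t • v) v) t
  deriv3 : ∀ x v t, HasDerivAt (fun t : ℝ => d2 (x + t • v) v) (d3 (x + t • v) v) t
  bound1 : ∀ x v, |d1 x v| ≤ C * ‖v‖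
  bound2 : ∀ x v, |d2 x v| ≤ C * ‖v‖ ^ 2
  bound3 : ∀ x v, |d3 x v| ≤ C * ‖v‖ ^ 3
  cont1 : ∀ x, Continuous (d1 x)
  cont2 : ∀ x, Continuous (d2 x)

theorem abs_sub_le_of_hasDerivAt_le {g g' : ℝ → ℝ} {b : ℝ} (hg : ∀ t, HasDerivAt g (g' t) t)
    (hb : ∀ t ∈ Set.Icc (0 : ℝ) 1, |g' t| ≤ b) {t : ℝ} (ht : t ∈ Set.Icc (0 : ℝ) 1) :
    |g t - g 0| ≤ b := by
  have h := (convex_Icc (0 : ℝ) 1).norm_image_sub_le_of_norm_hasDerivWithin_le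
    (fun s _ => (hg s).hasDerivWithinAt) hb (Set.left_mem_Icc.2 zero_le_one) ht
  rw [Real.norm_eq_abs, Real.norm_eq_abs, sub_zero, abs_of_nonneg ht.1] at h
  have hb0 : 0 ≤ b := (abs_nonneg _).trans (hb t ht)
  exact h.trans (mul_le_of_le_one_right hb0 ht.2)

namespace SmoothAlongLines

variable {f : V → ℝ} {d1 d2 d3 : V → V → ℝ} {C : ℝ}

theorem abs_sub_le (h : SmoothAlongLines f d1 d2 d3 C) (x v : V) :
    |f (x + v) - f x| ≤ C * ‖v‖ := by
  have := abs_sub_le_of_hasDerivAt_le (h.deriv1 x v) (fun t _ => h.bound1 _ _)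
    (Set.right_mem_Icc.2 zero_le_one)
  simpa using this

theorem abs_sub_sub_le (h : SmoothAlongLines f d1 d2 d3 C) (x v : V) :
    |f (x + v) - f x - d1 x v| ≤ C * ‖v‖ ^ 2 := by
  have h1 : ∀ t ∈ Set.Icc (0 : ℝ) 1, |d1 (x + t • v) v - d1 x v| ≤ C * ‖v‖ ^ 2 := fun t ht => by
    simpa using abs_sub_le_of_hasDerivAt_le (h.deriv2 x v) (fun t _ => h.bound2 _ _) ht
  have := abs_sub_le_of_hasDerivAt_le
    (fun t => (h.deriv1 x v t).sub ((hasDerivAt_id t).mul_const (d1 x v)))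
    (fun t ht => by simpa using h1 t ht) (Set.right_mem_Icc.2 zero_le_one)
  simp only [Pi.sub_apply, id_eq, one_smul, one_mul, zero_smul, add_zero, zero_mul, sub_zero] at this
  rw [show f (x + v) - f x - d1 x v = f (x + v) - d1 x v - f x by ring]
  exact this

theorem abs_sub_sub_sub_le (h : SmoothAlongLines f d1 d2 d3 C) (x v : V) :
    |f (x + v) - f x - d1 x v - d2 x v / 2| ≤ C * ‖v‖ ^ 3 := by
  have h2 : ∀ t ∈ Set.Icc (0 : ℝ) 1, |d2 (x + t • v) v - d2 x v| ≤ C * ‖v‖ ^ 3 := fun t ht => by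
    simpa using abs_sub_le_of_hasDerivAt_le (h.deriv3 x v) (fun t _ => h.bound3 _ _) ht
  have h1 : ∀ t ∈ Set.Icc (0 : ℝ) 1, |d1 (x + t • v) v - d1 x v - t * d2 x v| ≤ C * ‖v‖ ^ 3 := by
    intro t ht
    have := abs_sub_le_of_hasDerivAt_le
      (fun t => (h.deriv2 x v t).sub ((hasDerivAt_id t).mul_const (d2 x v)))
      (fun t ht => by simpa using h2 t ht) ht
    simp only [Pi.sub_apply, id_eq, zero_smul, add_zero, zero_mul, sub_zero] at this
    rw [show d1 (x + t • v) v - d1 x v - t * d2 x v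
      = d1 (x + t • v) v - t * d2 x v - d1 x v by ring]
    exact this
  have hd : ∀ t : ℝ, HasDerivAt (fun t : ℝ => f (x + t • v) - t * d1 x v - t ^ 2 * (d2 x v / 2))
      (d1 (x + t • v) v - d1 x v - t * d2 x v) t := fun t => by
    refine (((h.deriv1 x v t).sub ((hasDerivAt_id t).mul_const (d1 x v))).sub
      ((hasDerivAt_pow 2 t).mul_const (d2 x v / 2))).congr_deriv ?_
    simp
    ring
  have := abs_sub_le_of_hasDerivAt_le hd h1 (Set.right_mem_Icc.2 zero_le_one)
  simp only [one_smul, one_mul, one_pow, zero_smul, add_zero, zero_mul, sub_zero,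
    ne_eq, OfNat.ofNat_ne_zero, not_false_eq_true, zero_pow] at this
  rw [show f (x + v) - f x - d1 x v - d2 x v / 2 = f (x + v) - d1 x v - d2 x v / 2 - f x by ring]
  exact this

theorem continuous (h : SmoothAlongLines f d1 d2 d3 C) : Continuous f := by
  have : LipschitzWith ⟨C, h.nonneg⟩ f := LipschitzWith.of_dist_le_mul fun x y => by
    have := h.abs_sub_le y (x - y)
    rw [add_sub_cancel] at this
    rw [Real.dist_eq, dist_eq_norm]
    exact this
  exact this.continuous

theorem d1_smul (h : SmoothAlongLines f d1 d2 d3 C) (x v : V) (c : ℝ) :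
    d1 x (c • v) = c * d1 x v := by
  have h1 := h.deriv1 x (c • v) 0
  have h2 := HasDerivAt.scomp (𝕜 := ℝ) (𝕜' := ℝ) (0 : ℝ)
    (by simpa using h.deriv1 x v (0 * c)) ((hasDerivAt_id (0 : ℝ)).mul_const c)
  have h3 : (fun t : ℝ => f (x + t • v)) ∘ (fun y : ℝ => id y * c)
      = fun t : ℝ => f (x + t • c • v) := by
    ext t; simp [smul_smul]
  rw [h3] at h2
  simpa using h1.unique h2

theorem d2_smul (h : SmoothAlongLines f d1 d2 d3 C) (x v : V) (c : ℝ) :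
    d2 x (c • v) = c ^ 2 * d2 x v := by
  have h1 := h.deriv2 x (c • v) 0
  have h2 := HasDerivAt.scomp (𝕜 := ℝ) (𝕜' := ℝ) (0 : ℝ)
    (by simpa using h.deriv2 x v (0 * c)) ((hasDerivAt_id (0 : ℝ)).mul_const c)
  have h3 : (fun t : ℝ => d1 (x + t • c • v) (c • v))
      = fun t : ℝ => c * ((fun t : ℝ => d1 (x + t • v) v) ∘ (fun y : ℝ => id y * c)) t := by
    ext t; simp [smul_smul, h.d1_smul]
  rw [h3] at h1
  have h4 := h1.unique (h2.const_mul c)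
  simp at h4
  rw [h4]; ring

theorem d1_neg (h : SmoothAlongLines f d1 d2 d3 C) (x v : V) : d1 x (-v) = -d1 x v := by
  simpa using h.d1_smul x v (-1)

theorem abs_exp_sub_one_le (h : SmoothAlongLines f d1 d2 d3 C) (x v : V) :
    |Real.exp (f (x + v) - f x) - 1| ≤ C * ‖v‖ * Real.exp (C * ‖v‖) := by
  have h1 := h.abs_sub_le x v
  have h2 := Complex.norm_exp_sub_sum_le_norm_mul_exp ((f (x + v) - f x : ℝ) : ℂ) 1
  have h3 : ∑ m ∈ Finset.range 1, ((f (x + v) - f x : ℝ) : ℂ) ^ m / (m.factorial : ℂ)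
      = ((1 : ℝ) : ℂ) := by
    simp
  rw [h3, ← Complex.ofReal_exp, ← Complex.ofReal_sub, Complex.norm_real, Complex.norm_real,
    pow_one, Real.norm_eq_abs, Real.norm_eq_abs] at h2
  have hC := h.nonneg
  refine h2.trans ?_
  gcongr

/-- Second order expansion of `exp ∘ f`, with a remainder of order three. -/
theorem abs_exp_sub_taylor_le (h : SmoothAlongLines f d1 d2 d3 C) (x v : V) :
    |Real.exp (f (x + v) - f x) - 1 - d1 x v - (d2 x v + d1 x v ^ 2) / 2|
      ≤ (C + C ^ 2 + C ^ 3) * (‖v‖ ^ 3 * Real.exp (C * ‖v‖)) := by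
  have hC := h.nonneg
  have h1 := h.abs_sub_le x v
  have h2 := h.abs_sub_sub_le x v
  have h3 := h.abs_sub_sub_sub_le x v
  have h4 := h.bound1 x v
  set y := f (x + v) - f x with hy
  set a := d1 x v
  set b := d2 x v
  have he : |Real.exp y - (1 + y + y ^ 2 / 2)| ≤ |y| ^ 3 * Real.exp |y| := by
    have h2 := Complex.norm_exp_sub_sum_le_norm_mul_exp (y : ℂ) 3
    have h5 : ∑ m ∈ Finset.range 3, (y : ℂ) ^ m / (m.factorial : ℂ)
        = ((1 + y + y ^ 2 / 2 : ℝ) : ℂ) := by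
      simp [Finset.sum_range_succ]
    rw [h5, ← Complex.ofReal_exp, ← Complex.ofReal_sub, Complex.norm_real, Complex.norm_real] at h2
    exact h2
  have he' : |y| ^ 3 * Real.exp |y| ≤ (C * ‖v‖) ^ 3 * Real.exp (C * ‖v‖) := by gcongr
  have hq : |y ^ 2 - a ^ 2| ≤ 2 * C ^ 2 * ‖v‖ ^ 3 := by
    rw [show y ^ 2 - a ^ 2 = (y - a) * (y + a) by ring, abs_mul]
    have : |y + a| ≤ 2 * (C * ‖v‖) := (abs_add_le _ _).trans (by linarith)
    calc |y - a| * |y + a| ≤ (C * ‖v‖ ^ 2) * (2 * (C * ‖v‖)) := by gcongr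
      _ = _ := by ring
  have hE : 1 ≤ Real.exp (C * ‖v‖) := Real.one_le_exp (by positivity)
  have hp : 0 ≤ (C + C ^ 2) * ‖v‖ ^ 3 := by positivity
  have hsplit : Real.exp y - 1 - a - (b + a ^ 2) / 2
      = (Real.exp y - (1 + y + y ^ 2 / 2)) + (y - a - b / 2) + (y ^ 2 - a ^ 2) / 2 := by ring
  rw [hsplit]
  have h6 : |(y ^ 2 - a ^ 2) / 2| ≤ C ^ 2 * ‖v‖ ^ 3 := by
    rw [abs_div, abs_two]; linarith
  calc _ ≤ (C * ‖v‖) ^ 3 * Real.exp (C * ‖v‖) + C * ‖v‖ ^ 3 + C ^ 2 * ‖v‖ ^ 3 :=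
        (abs_add_three _ _ _).trans (add_le_add_three (he.trans he') h3 h6)
    _ ≤ _ := by nlinarith

end SmoothAlongLines

end SmoothAlongLines

/-! ### Gaussian comparison by interpolation -/

section Comparison

variable {V : Type*} [NormedAddCommGroup V] [NormedSpace ℝ V] [CompleteSpace V]
  [SecondCountableTopology V] [MeasurableSpace V] [BorelSpace V]

theorem norm_pow_le_exp (x : V) (k : ℕ) : ‖x‖ ^ k ≤ (k.factorial : ℝ) * Real.exp ‖x‖ := by
  have h := Real.pow_div_factorial_le_exp ‖x‖ (norm_nonneg x) k
  rwa [div_le_iff₀' (by positivity)] at h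

theorem integrable_norm_pow_mul_exp (μ : Measure V) [IsGaussian μ] (k : ℕ) (c : ℝ) :
    Integrable (fun x => ‖x‖ ^ k * Real.exp (c * ‖x‖)) μ := by
  refine integrable_of_abs_le_exp μ (by fun_prop) (k.factorial : ℝ) (1 + c) fun x => ?_
  rw [abs_of_nonneg (by positivity), add_mul, one_mul, Real.exp_add, ← mul_assoc]
  gcongr
  exact norm_pow_le_exp x k

namespace SmoothAlongLines

variable {f : V → ℝ} {d1 d2 d3 : V → V → ℝ} {C : ℝ}

theorem integrable (h : SmoothAlongLines f d1 d2 d3 C) (μ : Measure V) [IsGaussian μ] :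
    Integrable f μ := by
  have hC := h.nonneg
  refine integrable_of_abs_le_exp μ h.continuous (|f 0| + C) 1 fun x => ?_
  have h1 := h.abs_sub_le 0 x
  rw [zero_add] at h1
  have h2 : |f x| ≤ |f 0| + C * ‖x‖ := by
    have := abs_add_le (f 0) (f x - f 0)
    rw [add_sub_cancel] at this
    linarith
  have h3 : 1 ≤ Real.exp ‖x‖ := Real.one_le_exp (norm_nonneg x)
  have h4 : ‖x‖ ≤ Real.exp ‖x‖ := by linarith [Real.add_one_le_exp ‖x‖]
  rw [one_mul, add_mul]
  exact h2.trans (add_le_add (le_mul_of_one_le_right (abs_nonneg _) h3) (by gcongr))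

theorem exp_le (h : SmoothAlongLines f d1 d2 d3 C) (x : V) :
    Real.exp (f x) ≤ Real.exp (f 0) * Real.exp (C * ‖x‖) := by
  have h1 := h.abs_sub_le 0 x
  rw [zero_add] at h1
  rw [← Real.exp_add]
  exact Real.exp_le_exp.2 (by linarith [le_abs_self (f x - f 0)])

theorem integrable_exp (h : SmoothAlongLines f d1 d2 d3 C) (μ : Measure V) [IsGaussian μ] :
    Integrable (fun x => Real.exp (f x)) μ := by
  refine integrable_of_abs_le_exp μ (Real.continuous_exp.comp h.continuous)
    (Real.exp (f 0)) C fun x => ?_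
  rw [abs_of_pos (Real.exp_pos _)]
  exact h.exp_le x

theorem integrable_d1_sq (h : SmoothAlongLines f d1 d2 d3 C) (μ : Measure V) [IsGaussian μ]
    (x : V) : Integrable (fun v => d1 x v ^ 2) μ := by
  refine ((integrable_norm_pow_mul_exp μ 2 0).const_mul (C ^ 2)).mono'
    ((h.cont1 x).pow 2).measurable.aestronglyMeasurable (ae_of_all _ fun v => ?_)
  have := h.bound1 x v
  simp only [zero_mul, Real.exp_zero, mul_one, norm_pow, Real.norm_eq_abs]
  rw [← mul_pow]
  gcongr

theorem integrable_d2 (h : SmoothAlongLines f d1 d2 d3 C) (μ : Measure V) [IsGaussian μ]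
    (x : V) : Integrable (d2 x) μ := by
  refine ((integrable_norm_pow_mul_exp μ 2 0).const_mul C).mono'
    (h.cont2 x).measurable.aestronglyMeasurable (ae_of_all _ fun v => ?_)
  simpa using h.bound2 x v

theorem integrable_d1 (h : SmoothAlongLines f d1 d2 d3 C) (μ : Measure V) [IsGaussian μ]
    (x : V) : Integrable (d1 x) μ := by
  refine ((integrable_norm_pow_mul_exp μ 1 0).const_mul C).mono'
    (h.cont1 x).measurable.aestronglyMeasurable (ae_of_all _ fun v => ?_)
  simpa using h.bound1 x v

theorem integrable_exp_step (h : SmoothAlongLines f d1 d2 d3 C) (μ : Measure V) [IsGaussian μ]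
    (x : V) (σ : ℝ) : Integrable (fun v => Real.exp (f (x + σ • v) - f x)) μ := by
  have hc := h.continuous
  refine integrable_of_abs_le_exp μ (by fun_prop) 1 (C * |σ|) fun v => ?_
  rw [abs_of_pos (Real.exp_pos _), one_mul]
  refine Real.exp_le_exp.2 ((le_abs_self _).trans ((h.abs_sub_le _ _).trans_eq ?_))
  rw [norm_smul, Real.norm_eq_abs, mul_assoc]

/-- A Gaussian step of size `√τ` multiplies `exp ∘ f` by `1 + τ / 2 * ∫ (d2 + d1 ^ 2)`, up to an
error `O(τ ^ (3 / 2))` which is uniform in the starting point. -/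
theorem abs_integral_exp_step_le (h : SmoothAlongLines f d1 d2 d3 C) {μ : Measure V} [IsGaussian μ]
    (hμ : μ[id] = 0) (x : V) {τ : ℝ} (h0 : 0 ≤ τ) (h1 : τ ≤ 1) :
    |∫ v, Real.exp (f (x + √τ • v) - f x) ∂μ - 1 - τ / 2 * ∫ v, (d2 x v + d1 x v ^ 2) ∂μ|
      ≤ τ * √τ * ((C + C ^ 2 + C ^ 3) * ∫ v, ‖v‖ ^ 3 * Real.exp (C * ‖v‖) ∂μ) := by
  have hC := h.nonneg
  have hσ0 := Real.sqrt_nonneg τ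
  have hσ1 : √τ ≤ 1 := Real.sqrt_le_one.2 h1
  have hσ2 : √τ ^ 2 = τ := Real.sq_sqrt h0
  have hodd : ∫ v, d1 x v ∂μ = 0 := integral_eq_zero_of_odd hμ (h.cont1 x) (h.d1_neg x)
  have e1 : Integrable (fun v => Real.exp (f (x + √τ • v) - f x) - 1) μ :=
    (h.integrable_exp_step μ x _).sub (integrable_const _)
  have e2 : Integrable (fun v => √τ * d1 x v) μ := (h.integrable_d1 μ x).const_mul _
  have e3 : Integrable (fun v => τ / 2 * (d2 x v + d1 x v ^ 2)) μ :=
    ((h.integrable_d2 μ x).add (h.integrable_d1_sq μ x)).const_mul _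
  have key : ∫ v, Real.exp (f (x + √τ • v) - f x) ∂μ - 1
        - τ / 2 * ∫ v, (d2 x v + d1 x v ^ 2) ∂μ
      = ∫ v, (Real.exp (f (x + √τ • v) - f x) - 1 - √τ * d1 x v
          - τ / 2 * (d2 x v + d1 x v ^ 2)) ∂μ := by
    have e12 : Integrable (fun v => Real.exp (f (x + √τ • v) - f x) - 1 - √τ * d1 x v) μ :=
      e1.sub e2
    rw [integral_sub e12 e3, integral_sub e1 e2,
      integral_sub (h.integrable_exp_step μ x _) (integrable_const _), integral_const_mul,
      integral_const_mul, hodd]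
    simp
  rw [key, ← integral_const_mul, ← integral_const_mul]
  refine norm_integral_le_of_norm_le (G := ℝ)
    (((integrable_norm_pow_mul_exp μ 3 C).const_mul _).const_mul _) (ae_of_all _ fun v => ?_)
  have := h.abs_exp_sub_taylor_le x (√τ • v)
  rw [h.d1_smul, h.d2_smul, mul_pow, hσ2, norm_smul, Real.norm_of_nonneg hσ0] at this
  rw [Real.norm_eq_abs, show τ / 2 * (d2 x v + d1 x v ^ 2)
    = (τ * d2 x v + τ * d1 x v ^ 2) / 2 by ring]
  refine this.trans ?_
  have h5 : (√τ * ‖v‖) ^ 3 = τ * √τ * ‖v‖ ^ 3 := by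
    rw [mul_pow, pow_succ, hσ2]
  have h6 : Real.exp (C * (√τ * ‖v‖)) ≤ Real.exp (C * ‖v‖) := by
    refine Real.exp_le_exp.2 ?_
    gcongr
    exact mul_le_of_le_one_left (norm_nonneg v) hσ1
  rw [h5]
  calc (C + C ^ 2 + C ^ 3) * (τ * √τ * ‖v‖ ^ 3 * Real.exp (C * (√τ * ‖v‖)))
      ≤ (C + C ^ 2 + C ^ 3) * (τ * √τ * ‖v‖ ^ 3 * Real.exp (C * ‖v‖)) := by gcongr
    _ = _ := by ring

/-- The first-order counterpart of `abs_integral_exp_step_le`. -/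
theorem abs_integral_exp_step_sub_one_le (h : SmoothAlongLines f d1 d2 d3 C) (μ : Measure V)
    [IsGaussian μ] (x : V) {τ : ℝ} (h1 : τ ≤ 1) :
    |∫ v, Real.exp (f (x + √τ • v) - f x) ∂μ - 1|
      ≤ √τ * (C * ∫ v, ‖v‖ ^ 1 * Real.exp (C * ‖v‖) ∂μ) := by
  have hC := h.nonneg
  have hσ0 := Real.sqrt_nonneg τ
  have hσ1 : √τ ≤ 1 := Real.sqrt_le_one.2 h1
  have key : ∫ v, Real.exp (f (x + √τ • v) - f x) ∂μ - 1
      = ∫ v, (Real.exp (f (x + √τ • v) - f x) - 1) ∂μ := by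
    rw [integral_sub (h.integrable_exp_step μ x _) (integrable_const _)]
    simp
  rw [key, ← integral_const_mul, ← integral_const_mul]
  refine norm_integral_le_of_norm_le (G := ℝ)
    (((integrable_norm_pow_mul_exp μ 1 C).const_mul _).const_mul _) (ae_of_all _ fun v => ?_)
  refine (h.abs_exp_sub_one_le x (√τ • v)).trans ?_
  rw [norm_smul, Real.norm_of_nonneg hσ0, pow_one]
  have h6 : Real.exp (C * (√τ * ‖v‖)) ≤ Real.exp (C * ‖v‖) := by
    refine Real.exp_le_exp.2 ?_
    gcongr
    exact mul_le_of_le_one_left (norm_nonneg v) hσ1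
  calc C * (√τ * ‖v‖) * Real.exp (C * (√τ * ‖v‖))
      ≤ C * (√τ * ‖v‖) * Real.exp (C * ‖v‖) := by gcongr
    _ = _ := by ring

/-- Comparison of one Gaussian step of law `μ` with one of law `ν`. -/
theorem exists_integral_exp_step_le (h : SmoothAlongLines f d1 d2 d3 C) {μ ν : Measure V}
    [IsGaussian μ] [IsGaussian ν] (hμ : μ[id] = 0) (hν : ν[id] = 0) (κ : ℝ)
    (hq : ∀ x, ∫ v, (d2 x v + d1 x v ^ 2) ∂μ ≤ ∫ v, (d2 x v + d1 x v ^ 2) ∂ν + κ) :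
    ∃ D : ℝ, 0 ≤ D ∧ ∀ x τ, 0 ≤ τ → τ ≤ 1 →
      ∫ v, Real.exp (f (x + √τ • v)) ∂μ
        ≤ Real.exp (κ / 2 * τ) * ∫ v, Real.exp (f (x + √τ • v)) ∂ν
          + D * (τ * √τ) * Real.exp (f x) := by
  have hC := h.nonneg
  set A := (C + C ^ 2 + C ^ 3) * ∫ v, ‖v‖ ^ 3 * Real.exp (C * ‖v‖) ∂μ with hA
  set B := (C + C ^ 2 + C ^ 3) * ∫ v, ‖v‖ ^ 3 * Real.exp (C * ‖v‖) ∂ν with hB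
  set M := C * ∫ v, ‖v‖ ^ 1 * Real.exp (C * ‖v‖) ∂ν with hM
  have hA0 : 0 ≤ A := mul_nonneg (by positivity) (integral_nonneg fun v => by positivity)
  have hB0 : 0 ≤ B := mul_nonneg (by positivity) (integral_nonneg fun v => by positivity)
  have hM0 : 0 ≤ M := mul_nonneg (by positivity) (integral_nonneg fun v => by positivity)
  refine ⟨A + B + |κ| / 2 * M, by positivity, fun x τ h0 h1 => ?_⟩
  have s1 := (abs_le.1 (h.abs_integral_exp_step_le hμ x h0 h1)).2
  have s2 := (abs_le.1 (h.abs_integral_exp_step_le hν x h0 h1)).1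
  have s3 := h.abs_integral_exp_step_sub_one_le ν x h1
  rw [← hA] at s1
  rw [← hB] at s2
  rw [← hM] at s3
  have hsplit : ∀ ρ : Measure V, ∫ v, Real.exp (f (x + √τ • v)) ∂ρ
      = Real.exp (f x) * ∫ v, Real.exp (f (x + √τ • v) - f x) ∂ρ := fun ρ => by
    rw [← integral_const_mul]
    congr with v
    rw [← Real.exp_add, add_sub_cancel]
  rw [hsplit μ, hsplit ν]
  set I := ∫ v, Real.exp (f (x + √τ • v) - f x) ∂μ
  set J := ∫ v, Real.exp (f (x + √τ • v) - f x) ∂ν with hJ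
  have hJ0 : 0 ≤ J := integral_nonneg fun v => (Real.exp_pos _).le
  -- the step integral `J` is `1 + O(√τ)`, so that the slack `κ / 2 * τ` may be multiplied by `J`
  have s4 : κ / 2 * τ * (1 - J) ≤ |κ| / 2 * M * (τ * √τ) := by
    refine (le_abs_self _).trans ?_
    rw [abs_mul, abs_sub_comm 1 J, abs_mul, abs_div, abs_two, abs_of_nonneg h0]
    calc |κ| / 2 * τ * |J - 1| ≤ |κ| / 2 * τ * (√τ * M) := by gcongr
      _ = _ := by ring
  have s5 : (1 + κ / 2 * τ) * J ≤ Real.exp (κ / 2 * τ) * J := by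
    gcongr
    linarith [Real.add_one_le_exp (κ / 2 * τ)]
  have s6 : τ / 2 * ∫ v, (d2 x v + d1 x v ^ 2) ∂μ
      ≤ τ / 2 * (∫ v, (d2 x v + d1 x v ^ 2) ∂ν + κ) := by
    gcongr
    exact hq x
  have s7 : I ≤ Real.exp (κ / 2 * τ) * J + (A + B + |κ| / 2 * M) * (τ * √τ) := by
    linarith
  calc Real.exp (f x) * I
      ≤ Real.exp (f x) * (Real.exp (κ / 2 * τ) * J + (A + B + |κ| / 2 * M) * (τ * √τ)) := by gcongr
    _ = _ := by ring

/-- **Gaussian comparison.** If the second-order effect of a Gaussian perturbation of law `μ` on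
`exp ∘ f` exceeds that of law `ν` by at most `κ` at every point, then
`∫ exp f ∂μ ≤ exp (κ / 2) * ∫ exp f ∂ν`. -/
theorem integral_exp_le_of_comparison (h : SmoothAlongLines f d1 d2 d3 C) {μ ν : Measure V}
    [IsGaussian μ] [IsGaussian ν] (hμ : μ[id] = 0) (hν : ν[id] = 0) (κ : ℝ)
    (hq : ∀ x, ∫ v, (d2 x v + d1 x v ^ 2) ∂μ ≤ ∫ v, (d2 x v + d1 x v ^ 2) ∂ν + κ) :
    ∫ x, Real.exp (f x) ∂μ ≤ Real.exp (κ / 2) * ∫ x, Real.exp (f x) ∂ν := by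
  obtain ⟨D, hD0, hD⟩ := h.exists_integral_exp_step_le hμ hν κ hq
  have hC := h.nonneg
  have hce : Continuous fun x => Real.exp (f x) := Real.continuous_exp.comp h.continuous
  set K := Real.exp (f 0) * ((∫ x, Real.exp (C * ‖x‖) ∂μ) * ∫ x, Real.exp (C * ‖x‖) ∂ν) with hK
  have hK0 : 0 ≤ K := mul_nonneg (Real.exp_pos _).le (mul_nonneg
    (integral_nonneg fun v => (Real.exp_pos _).le) (integral_nonneg fun v => (Real.exp_pos _).le))
  -- the uniform bound on the intermediate exponential moments
  have hbound : ∀ s t, s ≤ 1 → t ≤ 1 →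
      ∫ x, Real.exp (f x) ∂(gaussianScale μ s ∗ gaussianScale ν t) ≤ K := by
    intro s t hs1 ht1
    have hscale : ∀ (ρ : Measure V) [IsGaussian ρ] (s : ℝ), s ≤ 1 →
        ∫ x, Real.exp (C * ‖x‖) ∂(gaussianScale ρ s) ≤ ∫ x, Real.exp (C * ‖x‖) ∂ρ := by
      intro ρ _ s hs
      rw [integral_gaussianScale ρ s (by fun_prop)]
      have hle : ∀ x : V, Real.exp (C * ‖√s • x‖) ≤ Real.exp (C * ‖x‖) := fun x => by
        refine Real.exp_le_exp.2 ?_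
        rw [norm_smul, Real.norm_of_nonneg (Real.sqrt_nonneg s)]
        gcongr
        exact mul_le_of_le_one_left (norm_nonneg x) (Real.sqrt_le_one.2 hs)
      refine integral_mono_of_nonneg (ae_of_all _ fun x => (Real.exp_pos _).le)
        (integrable_exp_mul_norm ρ C) (ae_of_all _ hle)
    calc ∫ x, Real.exp (f x) ∂(gaussianScale μ s ∗ gaussianScale ν t)
        = ∫ z, Real.exp (f (z.1 + z.2)) ∂((gaussianScale μ s).prod (gaussianScale ν t)) := by
          rw [Measure.conv, integral_map (by fun_prop) hce.measurable.aestronglyMeasurable]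
      _ ≤ ∫ z, Real.exp (f 0) * (Real.exp (C * ‖z.1‖) * Real.exp (C * ‖z.2‖))
            ∂((gaussianScale μ s).prod (gaussianScale ν t)) := by
          refine integral_mono_of_nonneg (ae_of_all _ fun x => (Real.exp_pos _).le) ?_
            (ae_of_all _ fun z => ?_)
          · exact ((integrable_exp_mul_norm _ C).mul_prod (integrable_exp_mul_norm _ C)).const_mul _
          · refine (h.exp_le _).trans ?_
            simp only
            rw [← Real.exp_add (C * ‖z.1‖), ← mul_add]
            gcongr
            exact norm_add_le _ _
      _ = Real.exp (f 0) * ((∫ x, Real.exp (C * ‖x‖) ∂(gaussianScale μ s))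
            * ∫ x, Real.exp (C * ‖x‖) ∂(gaussianScale ν t)) := by
          rw [integral_const_mul, integral_prod_mul (fun x : V => Real.exp (C * ‖x‖))
            (fun x : V => Real.exp (C * ‖x‖))]
      _ ≤ K := by
          exact mul_le_mul_of_nonneg_left (mul_le_mul (hscale μ s hs1) (hscale ν t ht1)
            (integral_nonneg fun v => (Real.exp_pos _).le)
            (integral_nonneg fun v => (Real.exp_pos _).le)) (Real.exp_pos _).le
  -- `φ` interpolates between the exponential moments under `ν` and under `μ`
  set φ : ℝ → ℝ := fun t =>
    ∫ x, Real.exp (f x) ∂(gaussianScale μ t ∗ gaussianScale ν (1 - t)) with hφ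
  have hstep : ∀ t τ, 0 ≤ t → 0 ≤ τ → t + τ ≤ 1 →
      φ (t + τ) ≤ Real.exp (κ / 2 * τ) * φ t + D * (τ * √τ) * K := by
    intro t τ ht hτ htτ
    -- the two laws share the factor `π` and differ by one step, of law `μ` or `ν`
    set π := gaussianScale μ t ∗ gaussianScale ν (1 - t - τ) with hπ
    have e1 : gaussianScale μ (t + τ) ∗ gaussianScale ν (1 - (t + τ))
        = π ∗ gaussianScale μ τ := by
      rw [hπ, ← gaussianScale_conv hμ ht hτ, Measure.conv_assoc, Measure.conv_assoc,
        Measure.conv_comm (gaussianScale μ τ), sub_sub]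
    have e2 : gaussianScale μ t ∗ gaussianScale ν (1 - t) = π ∗ gaussianScale ν τ := by
      rw [hπ, Measure.conv_assoc, gaussianScale_conv hν (by linarith) hτ, sub_add_cancel]
    have hin : ∀ ρ : Measure V, ∀ x, ∫ y, Real.exp (f (x + y)) ∂(gaussianScale ρ τ)
        = ∫ v, Real.exp (f (x + √τ • v)) ∂ρ := fun ρ x =>
      integral_gaussianScale ρ τ (hce.comp (continuous_const.add continuous_id))
    have hint : ∀ (ρ : Measure V) [IsGaussian ρ],
        Integrable (fun x => ∫ v, Real.exp (f (x + √τ • v)) ∂ρ) π := by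
      intro ρ _
      have h1 : Integrable (fun x => Real.exp (f x)) (π ∗ gaussianScale ρ τ) := h.integrable_exp _
      have h2 := ((integrable_map_measure hce.measurable.aestronglyMeasurable
        (by fun_prop)).1 h1).integral_prod_left
      refine h2.congr (ae_of_all _ fun x => hin ρ x)
    have hφ1 : φ (t + τ) = ∫ x, ∫ v, Real.exp (f (x + √τ • v)) ∂μ ∂π := by
      simp only [hφ]
      rw [e1, integral_conv_real _ _ hce (h.integrable_exp _)]
      simp only [hin]
    have hφ2 : φ t = ∫ x, ∫ v, Real.exp (f (x + √τ • v)) ∂ν ∂π := by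
      simp only [hφ]
      rw [e2, integral_conv_real _ _ hce (h.integrable_exp _)]
      simp only [hin]
    rw [hφ1, hφ2]
    calc ∫ x, ∫ v, Real.exp (f (x + √τ • v)) ∂μ ∂π
        ≤ ∫ x, (Real.exp (κ / 2 * τ) * ∫ v, Real.exp (f (x + √τ • v)) ∂ν
          + D * (τ * √τ) * Real.exp (f x)) ∂π :=
          integral_mono (hint μ) (((hint ν).const_mul _).add ((h.integrable_exp π).const_mul _))
            fun x => hD x τ hτ (by linarith)
      _ = Real.exp (κ / 2 * τ) * ∫ x, ∫ v, Real.exp (f (x + √τ • v)) ∂ν ∂π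
          + D * (τ * √τ) * ∫ x, Real.exp (f x) ∂π := by
          rw [integral_add ((hint ν).const_mul _) ((h.integrable_exp π).const_mul _),
            integral_const_mul, integral_const_mul]
      _ ≤ _ := by
          gcongr
          exact hbound _ _ (by linarith) (by linarith)
  have hφ0 : φ 0 = ∫ x, Real.exp (f x) ∂ν := by
    simp only [hφ]
    rw [gaussianScale_zero, sub_zero, gaussianScale_one, Measure.dirac_zero_conv]
  have hφ1 : φ 1 = ∫ x, Real.exp (f x) ∂μ := by
    simp only [hφ]
    rw [sub_self, gaussianScale_zero, gaussianScale_one, Measure.conv_dirac_zero]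
  rw [← hφ0, ← hφ1]
  -- `m` steps of length `1 / m` accumulate an error of order `m ^ (-1 / 2)`
  set E := Real.exp (|κ| / 2) * (D * K) with hE
  have hiter : ∀ m : ℕ, 0 < m → φ 1 ≤ Real.exp (κ / 2) * φ 0 + E * √(1 / m) := by
    intro m hm
    have hm' : (0 : ℝ) < m := Nat.cast_pos.2 hm
    set τ : ℝ := 1 / m with hτ
    have hτ0 : 0 < τ := by positivity
    have hmτ : m * τ = 1 := by rw [hτ]; field_simp
    have hind : ∀ j : ℕ, j ≤ m →
        φ (j * τ) ≤ Real.exp (κ / 2 * (j * τ)) * φ 0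
          + j * (τ * √τ) * (Real.exp (|κ| / 2 * (j * τ)) * (D * K)) := by
      intro j
      induction j with
      | zero => intro _; simp
      | succ j ih =>
        intro hj
        have ih' := ih (by omega)
        have hj1 : ((j : ℝ) + 1) * τ ≤ 1 := by
          refine le_trans ?_ hmτ.le
          gcongr
          exact_mod_cast hj
        have hs := hstep (j * τ) τ (by positivity) hτ0.le (by linarith)
        push_cast
        rw [add_mul, one_mul]
        have hexp : Real.exp (κ / 2 * (j * τ + τ))
            = Real.exp (κ / 2 * τ) * Real.exp (κ / 2 * (j * τ)) := by
          rw [← Real.exp_add]; ring_nf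
        have hexp' : Real.exp (|κ| / 2 * (j * τ + τ))
            = Real.exp (|κ| / 2 * τ) * Real.exp (|κ| / 2 * (j * τ)) := by
          rw [← Real.exp_add]; ring_nf
        have hone : 1 ≤ Real.exp (|κ| / 2 * (j * τ + τ)) := Real.one_le_exp (by positivity)
        have hκ : Real.exp (κ / 2 * τ) ≤ Real.exp (|κ| / 2 * τ) := by
          refine Real.exp_le_exp.2 ?_
          gcongr
          exact le_abs_self κ
        set w := τ * √τ with hw
        have hw0 : 0 ≤ w := by positivity
        calc φ (j * τ + τ)
            ≤ Real.exp (κ / 2 * τ) * (Real.exp (κ / 2 * (j * τ)) * φ 0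
                + j * w * (Real.exp (|κ| / 2 * (j * τ)) * (D * K))) + D * w * K := by
              refine hs.trans ?_
              gcongr
          _ = Real.exp (κ / 2 * (j * τ + τ)) * φ 0
                + j * w * (Real.exp (κ / 2 * τ) * Real.exp (|κ| / 2 * (j * τ)) * (D * K))
                + w * (1 * (D * K)) := by
              rw [hexp]; ring
          _ ≤ Real.exp (κ / 2 * (j * τ + τ)) * φ 0
                + j * w * (Real.exp (|κ| / 2 * τ) * Real.exp (|κ| / 2 * (j * τ)) * (D * K))
                + w * (Real.exp (|κ| / 2 * (j * τ + τ)) * (D * K)) := by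
              gcongr
          _ = _ := by
              rw [← hexp']; ring
    have := hind m le_rfl
    rw [hmτ, mul_one, mul_one, ← hE, ← mul_assoc (m : ℝ), hmτ, one_mul, mul_comm _ E] at this
    exact this
  have hlim : Filter.Tendsto (fun m : ℕ => Real.exp (κ / 2) * φ 0 + E * √(1 / m))
      Filter.atTop (nhds (Real.exp (κ / 2) * φ 0 + E * √0)) :=
    ((Real.continuous_sqrt.tendsto 0).comp
      tendsto_one_div_atTop_nhds_zero_nat).const_mul E |>.const_add _
  rw [Real.sqrt_zero, mul_zero, add_zero] at hlim
  exact ge_of_tendsto hlim (Filter.eventually_atTop.2 ⟨1, fun m hm => hiter m hm⟩)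

end SmoothAlongLines

end Comparison

/-! ### Gaussian concentration -/

section Concentration

namespace SmoothAlongLines

section Algebra

variable {V W : Type*} [NormedAddCommGroup V] [NormedSpace ℝ V] [NormedAddCommGroup W]
  [NormedSpace ℝ W] {f g : V → ℝ} {d1 d2 d3 e1 e2 e3 : V → V → ℝ} {C D : ℝ}

theorem const_mul (h : SmoothAlongLines f d1 d2 d3 C) (c : ℝ) :
    SmoothAlongLines (fun x => c * f x) (fun x v => c * d1 x v) (fun x v => c * d2 x v)
      (fun x v => c * d3 x v) (|c| * C) where
  nonneg := mul_nonneg (abs_nonneg c) h.nonneg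
  deriv1 x v t := (h.deriv1 x v t).const_mul c
  deriv2 x v t := (h.deriv2 x v t).const_mul c
  deriv3 x v t := (h.deriv3 x v t).const_mul c
  bound1 x v := by
    rw [abs_mul, mul_assoc]; exact mul_le_mul_of_nonneg_left (h.bound1 x v) (abs_nonneg c)
  bound2 x v := by
    rw [abs_mul, mul_assoc]; exact mul_le_mul_of_nonneg_left (h.bound2 x v) (abs_nonneg c)
  bound3 x v := by
    rw [abs_mul, mul_assoc]; exact mul_le_mul_of_nonneg_left (h.bound3 x v) (abs_nonneg c)
  cont1 x := (h.cont1 x).const_mul c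
  cont2 x := (h.cont2 x).const_mul c

theorem add (h : SmoothAlongLines f d1 d2 d3 C) (k : SmoothAlongLines g e1 e2 e3 D) :
    SmoothAlongLines (fun x => f x + g x) (fun x v => d1 x v + e1 x v)
      (fun x v => d2 x v + e2 x v) (fun x v => d3 x v + e3 x v) (C + D) where
  nonneg := add_nonneg h.nonneg k.nonneg
  deriv1 x v t := (h.deriv1 x v t).add (k.deriv1 x v t)
  deriv2 x v t := (h.deriv2 x v t).add (k.deriv2 x v t)
  deriv3 x v t := (h.deriv3 x v t).add (k.deriv3 x v t)
  bound1 x v := by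
    rw [add_mul]; exact (abs_add_le _ _).trans (add_le_add (h.bound1 x v) (k.bound1 x v))
  bound2 x v := by
    rw [add_mul]; exact (abs_add_le _ _).trans (add_le_add (h.bound2 x v) (k.bound2 x v))
  bound3 x v := by
    rw [add_mul]; exact (abs_add_le _ _).trans (add_le_add (h.bound3 x v) (k.bound3 x v))
  cont1 x := (h.cont1 x).add (k.cont1 x)
  cont2 x := (h.cont2 x).add (k.cont2 x)

theorem comp_clm (h : SmoothAlongLines f d1 d2 d3 C) (A : W →L[ℝ] V) :
    SmoothAlongLines (fun x => f (A x)) (fun x v => d1 (A x) (A v)) (fun x v => d2 (A x) (A v))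
      (fun x v => d3 (A x) (A v)) (C * (1 + ‖A‖) ^ 3) := by
  have hC := h.nonneg
  have key : ∀ (j : ℕ), j ≤ 3 → ∀ v, C * ‖A v‖ ^ j ≤ C * (1 + ‖A‖) ^ 3 * ‖v‖ ^ j := by
    intro j hj v
    rw [mul_assoc]
    refine mul_le_mul_of_nonneg_left ?_ hC
    have hA : 0 ≤ ‖A‖ := norm_nonneg A
    calc ‖A v‖ ^ j ≤ (‖A‖ * ‖v‖) ^ j := by gcongr; exact A.le_opNorm v
      _ = ‖A‖ ^ j * ‖v‖ ^ j := mul_pow _ _ _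
      _ ≤ (1 + ‖A‖) ^ j * ‖v‖ ^ j := by gcongr; linarith
      _ ≤ (1 + ‖A‖) ^ 3 * ‖v‖ ^ j := by gcongr; linarith
  exact
  { nonneg := mul_nonneg hC (by positivity)
    deriv1 := fun x v t => by simpa using h.deriv1 (A x) (A v) t
    deriv2 := fun x v t => by simpa using h.deriv2 (A x) (A v) t
    deriv3 := fun x v t => by simpa using h.deriv3 (A x) (A v) t
    bound1 := fun x v => by
      have := key 1 (by norm_num) v
      rw [pow_one, pow_one] at this
      exact (h.bound1 _ _).trans this
    bound2 := fun x v => (h.bound2 _ _).trans (key 2 (by norm_num) v)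
    bound3 := fun x v => (h.bound3 _ _).trans (key 3 (by norm_num) v)
    cont1 := fun x => (h.cont1 _).comp A.continuous
    cont2 := fun x => (h.cont2 _).comp A.continuous }

end Algebra

section Gaussian

variable {V : Type*} [NormedAddCommGroup V] [NormedSpace ℝ V] [CompleteSpace V]
  [SecondCountableTopology V] [MeasurableSpace V] [BorelSpace V]
  {f : V → ℝ} {d1 d2 d3 : V → V → ℝ} {C : ℝ}

theorem integral_id_map_eq_zero {W : Type*} [NormedAddCommGroup W] [NormedSpace ℝ W]
    [CompleteSpace W] [SecondCountableTopology W] [MeasurableSpace W] [BorelSpace W]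
    {μ : Measure V} [IsGaussian μ] (hμ : μ[id] = 0) (A : V →L[ℝ] W) : (μ.map A)[id] = 0 := by
  have h := A.integral_id_map (μ := μ) IsGaussian.integrable_id
  simp only [id_eq] at hμ h ⊢
  rw [h, hμ, map_zero]

theorem integral_id_prod_eq_zero {W : Type*} [NormedAddCommGroup W] [NormedSpace ℝ W]
    [CompleteSpace W] [SecondCountableTopology W] [MeasurableSpace W] [BorelSpace W]
    {μ : Measure V} {ν : Measure W} [IsGaussian μ] [IsGaussian ν]
    (hμ : μ[id] = 0) (hν : ν[id] = 0) : (μ.prod ν)[id] = 0 := by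
  have hi : Integrable (fun z : V × W => z) (μ.prod ν) := IsGaussian.integrable_id
  simp only [id_eq] at hμ hν ⊢
  refine Prod.ext ?_ ?_
  · rw [fst_integral hi, integral_fun_fst (fun x : V => x), hμ]
    simp
  · rw [snd_integral hi, integral_fun_snd (fun x : W => x), hν]
    simp

/-- Comparing `(X, X)` with two independent copies `(X, X')`: halving `f` while squaring the
exponential moment costs a factor `exp (κ / 4)`. -/
theorem integral_exp_le_sq (h : SmoothAlongLines f d1 d2 d3 C) {ν : Measure V} [IsGaussian ν]
    (hν : ν[id] = 0) {κ : ℝ} (hκ : ∀ x, ∫ v, d1 x v ^ 2 ∂ν ≤ κ) :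
    ∫ x, Real.exp (f x) ∂ν ≤ Real.exp (κ / 4) * (∫ x, Real.exp (1 / 2 * f x) ∂ν) ^ 2 := by
  let diag : V →L[ℝ] V × V := (ContinuousLinearMap.id ℝ V).prod (ContinuousLinearMap.id ℝ V)
  have hF := ((h.comp_clm (ContinuousLinearMap.fst ℝ V V)).add
    (h.comp_clm (ContinuousLinearMap.snd ℝ V V))).const_mul (1 / 2)
  have hd : (ν.map diag)[id] = 0 := integral_id_map_eq_zero hν diag
  have key := hF.integral_exp_le_of_comparison (μ := ν.map diag) (ν := ν.prod ν) hd
    (integral_id_prod_eq_zero hν hν) (κ / 2) ?_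
  · have hce : Continuous fun x : V × V => Real.exp ((1 : ℝ) / 2 *
        (f (ContinuousLinearMap.fst ℝ V V x) + f (ContinuousLinearMap.snd ℝ V V x))) :=
      Real.continuous_exp.comp hF.continuous
    rw [integral_map (by fun_prop) hce.measurable.aestronglyMeasurable] at key
    have e1 : ∀ x, (1 : ℝ) / 2 * (f (ContinuousLinearMap.fst ℝ V V (diag x))
        + f (ContinuousLinearMap.snd ℝ V V (diag x))) = f x := fun x => by
      simp [diag]; ring
    simp only [e1] at key
    have e2 : ∀ x : V × V, Real.exp ((1 : ℝ) / 2 * (f (ContinuousLinearMap.fst ℝ V V x)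
        + f (ContinuousLinearMap.snd ℝ V V x)))
        = Real.exp (1 / 2 * f x.1) * Real.exp (1 / 2 * f x.2) := fun x => by
      rw [← Real.exp_add, ← mul_add]; rfl
    simp only [e2] at key
    rw [integral_prod_mul (fun x => Real.exp (1 / 2 * f x)) (fun x => Real.exp (1 / 2 * f x)),
      ← pow_two, div_div] at key
    norm_num at key ⊢
    exact key
  · rintro ⟨x, y⟩
    have hc1 : Continuous fun v : V × V => (1 : ℝ) / 2 * (d2 x v.1 + d2 y v.2)
        + (1 / 2 * (d1 x v.1 + d1 y v.2)) ^ 2 := by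
      have := h.cont1 x
      have := h.cont1 y
      have := h.cont2 x
      have := h.cont2 y
      fun_prop
    simp only [ContinuousLinearMap.coe_fst', ContinuousLinearMap.coe_snd']
    rw [integral_map (by fun_prop) hc1.measurable.aestronglyMeasurable]
    have i1 := h.integrable_d2 ν x
    have i2 := h.integrable_d2 ν y
    have j1 := h.integrable_d1_sq ν x
    have j2 := h.integrable_d1_sq ν y
    have k1 : Integrable (fun v : V × V => d2 x v.1) (ν.prod ν) := i1.comp_fst ν
    have k2 : Integrable (fun v : V × V => d2 y v.2) (ν.prod ν) := i2.comp_snd ν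
    have l1 : Integrable (fun v : V × V => d1 x v.1 ^ 2) (ν.prod ν) := j1.comp_fst ν
    have l2 : Integrable (fun v : V × V => d1 y v.2 ^ 2) (ν.prod ν) := j2.comp_snd ν
    have m : Integrable (fun v : V × V => d1 x v.1 * d1 y v.2) (ν.prod ν) :=
      (h.integrable_d1 ν x).mul_prod (h.integrable_d1 ν y)
    have k12 : Integrable (fun v : V × V => (1 : ℝ) / 2 * (d2 x v.1 + d2 y v.2)) (ν.prod ν) :=
      (k1.add k2).const_mul _
    have l12 : Integrable (fun v : V × V => (1 : ℝ) / 4 * (d1 x v.1 ^ 2 + d1 y v.2 ^ 2))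
        (ν.prod ν) := (l1.add l2).const_mul _
    have kl : Integrable (fun v : V × V => (1 : ℝ) / 2 * (d2 x v.1 + d2 y v.2)
        + 1 / 4 * (d1 x v.1 ^ 2 + d1 y v.2 ^ 2)) (ν.prod ν) := k12.add l12
    have i12 : Integrable (fun v => (1 : ℝ) / 2 * (d2 x v + d2 y v)) ν :=
      (i1.add i2).const_mul _
    have j12 : Integrable (fun v => (1 : ℝ) / 2 * (d1 x v ^ 2 + d1 y v ^ 2)) ν :=
      (j1.add j2).const_mul _
    -- under the product law the cross term vanishes, under the diagonal law it is bounded by the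
    -- squares; the second derivatives contribute equally
    have hodd : ∫ v, d1 x v ∂ν = 0 := integral_eq_zero_of_odd hν (h.cont1 x) (h.d1_neg x)
    have hR : ∫ v : V × V, ((1 : ℝ) / 2 * (d2 x v.1 + d2 y v.2)
          + (1 / 2 * (d1 x v.1 + d1 y v.2)) ^ 2) ∂(ν.prod ν)
        = 1 / 2 * (∫ v, d2 x v ∂ν + ∫ v, d2 y v ∂ν)
          + 1 / 4 * (∫ v, d1 x v ^ 2 ∂ν + ∫ v, d1 y v ^ 2 ∂ν) := by
      have e : ∀ v : V × V, (1 : ℝ) / 2 * (d2 x v.1 + d2 y v.2)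
          + (1 / 2 * (d1 x v.1 + d1 y v.2)) ^ 2
          = (1 / 2 * (d2 x v.1 + d2 y v.2) + 1 / 4 * (d1 x v.1 ^ 2 + d1 y v.2 ^ 2))
            + 1 / 2 * (d1 x v.1 * d1 y v.2) := fun v => by ring
      simp only [e]
      rw [integral_add kl (m.const_mul _), integral_add k12 l12,
        integral_const_mul, integral_const_mul, integral_const_mul, integral_add k1 k2,
        integral_add l1 l2, integral_prod_mul, hodd, integral_fun_fst (d2 x),
        integral_fun_snd (d2 y), integral_fun_fst (fun v => d1 x v ^ 2),
        integral_fun_snd (fun v => d1 y v ^ 2)]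
      simp
    rw [hR]
    have hL : ∫ v, ((1 : ℝ) / 2 * (d2 x (diag v).1 + d2 y (diag v).2)
          + (1 / 2 * (d1 x (diag v).1 + d1 y (diag v).2)) ^ 2) ∂ν
        ≤ 1 / 2 * (∫ v, d2 x v ∂ν + ∫ v, d2 y v ∂ν)
          + 1 / 2 * (∫ v, d1 x v ^ 2 ∂ν + ∫ v, d1 y v ^ 2 ∂ν) := by
      rw [← integral_add i1 i2, ← integral_add j1 j2, ← integral_const_mul, ← integral_const_mul,
        ← integral_add i12 j12]
      have hpt : ∀ v, (1 : ℝ) / 2 * (d2 x v + d2 y v) + (1 / 2 * (d1 x v + d1 y v)) ^ 2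
          ≤ 1 / 2 * (d2 x v + d2 y v) + 1 / 2 * (d1 x v ^ 2 + d1 y v ^ 2) := fun v => by
        nlinarith [sq_nonneg (d1 x v - d1 y v)]
      refine integral_mono ?_ (i12.add j12) hpt
      have hF1 := hF.integrable_d1_sq (ν.map diag) (x, y)
      have hF2 := hF.integrable_d2 (ν.map diag) (x, y)
      exact (integrable_map_measure hc1.measurable.aestronglyMeasurable (by fun_prop)).1
        (hF2.add hF1)
    linarith [hκ x, hκ y]

/-- **Gaussian concentration**, with the sharp constant: if the directional derivative of `f` has
second moment at most `κ` under `ν`, at every point, then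
`∫ exp f ∂ν ≤ exp (κ / 2) * exp (∫ f ∂ν)`. -/
theorem integral_exp_le_exp_integral (h : SmoothAlongLines f d1 d2 d3 C) {ν : Measure V}
    [IsGaussian ν] (hν : ν[id] = 0) {κ : ℝ} (hκ : ∀ x, ∫ v, d1 x v ^ 2 ∂ν ≤ κ) :
    ∫ x, Real.exp (f x) ∂ν ≤ Real.exp (κ / 2 + ∫ x, f x ∂ν) := by
  -- iterating the halving step `j` times costs `κ * (1 / 4 + 1 / 8 + ...) ≤ κ / 2`
  have hiter : ∀ j : ℕ, ∫ x, Real.exp (f x) ∂ν ≤ Real.exp (κ / 2 * (1 - (1 / 2) ^ j))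
      * (∫ x, Real.exp ((1 / 2) ^ j * f x) ∂ν) ^ (2 ^ j) := by
    intro j
    induction j with
    | zero => simp
    | succ j ih =>
      refine ih.trans ?_
      have hs := (h.const_mul ((1 / 2) ^ j)).integral_exp_le_sq hν (κ := (1 / 4) ^ j * κ)
        fun x => by
          simp only [mul_pow]
          rw [integral_const_mul, ← pow_mul, mul_comm j, pow_mul]
          norm_num
          exact hκ x
      have hs2 : (∫ x, Real.exp ((1 / 2) ^ j * f x) ∂ν) ^ (2 ^ j)
          ≤ (Real.exp ((1 / 4) ^ j * κ / 4)
            * (∫ x, Real.exp (1 / 2 * ((1 / 2) ^ j * f x)) ∂ν) ^ 2) ^ (2 ^ j) :=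
        pow_le_pow_left₀ (integral_nonneg fun x => (Real.exp_pos _).le) hs _
      refine (mul_le_mul_of_nonneg_left hs2 (Real.exp_pos _).le).trans_eq ?_
      rw [mul_pow, ← pow_mul, ← pow_succ', ← mul_assoc, ← Real.exp_nat_mul, ← Real.exp_add]
      have e : ∀ x, 1 / 2 * ((1 / 2) ^ j * f x) = (1 / 2) ^ (j + 1) * f x := fun x => by ring
      simp only [e]
      congr 2
      have e4 : ((1 : ℝ) / 4) ^ j = (1 / 2) ^ j * (1 / 2) ^ j := by
        rw [← mul_pow]; norm_num
      have e2 : (2 : ℝ) ^ j * (1 / 2) ^ j = 1 := by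
        rw [← mul_pow]; norm_num
      push_cast
      rw [e4, pow_succ]
      linear_combination (κ / 4 * (1 / 2) ^ j) * e2
  have hC := h.nonneg
  have hκ0 : 0 ≤ κ := (integral_nonneg fun v => sq_nonneg _).trans (hκ 0)
  have hif := h.integrable ν
  have hcf := h.continuous
  -- expansion of `exp (ε f)` for small `ε`
  have him : Integrable (fun x => f x ^ 2 * Real.exp |f x|) ν := by
    refine integrable_of_abs_le_exp ν (by fun_prop) (2 * Real.exp (2 * |f 0|)) (2 * C) fun x => ?_
    have h1 := h.abs_sub_le 0 x
    rw [zero_add] at h1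
    have h2 : |f x| ≤ |f 0| + C * ‖x‖ := by
      have := abs_add_le (f 0) (f x - f 0)
      rw [add_sub_cancel] at this
      linarith
    have h3 := norm_pow_le_exp (f x) 2
    rw [abs_of_nonneg (by positivity)]
    rw [Real.norm_eq_abs, sq_abs] at h3
    calc f x ^ 2 * Real.exp |f x| ≤ (2 * Real.exp |f x|) * Real.exp |f x| := by
          gcongr
          exact_mod_cast h3
      _ = 2 * Real.exp (2 * |f x|) := by rw [mul_assoc, ← Real.exp_add]; ring_nf
      _ ≤ 2 * Real.exp (2 * |f 0| + 2 * C * ‖x‖) := by gcongr; linarith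
      _ = _ := by rw [Real.exp_add]; ring
  set M := ∫ x, f x ^ 2 * Real.exp |f x| ∂ν with hM
  have hsmall : ∀ ε : ℝ, 0 ≤ ε → ε ≤ 1 →
      ∫ x, Real.exp (ε * f x) ∂ν ≤ Real.exp (ε * ∫ x, f x ∂ν + ε ^ 2 * M) := by
    intro ε h0 h1
    have hpt : ∀ x, Real.exp (ε * f x) ≤ 1 + ε * f x + ε ^ 2 * (f x ^ 2 * Real.exp |f x|) := by
      intro x
      have h2 := Complex.norm_exp_sub_sum_le_norm_mul_exp ((ε * f x : ℝ) : ℂ) 2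
      have h5 : ∑ m ∈ Finset.range 2, ((ε * f x : ℝ) : ℂ) ^ m / (m.factorial : ℂ)
          = ((1 + ε * f x : ℝ) : ℂ) := by
        simp [Finset.sum_range_succ]
      rw [h5, ← Complex.ofReal_exp, ← Complex.ofReal_sub, Complex.norm_real, Complex.norm_real,
        Real.norm_eq_abs, Real.norm_eq_abs, sq_abs] at h2
      have h6 : Real.exp |ε * f x| ≤ Real.exp |f x| := by
        refine Real.exp_le_exp.2 ?_
        rw [abs_mul, abs_of_nonneg h0]
        exact mul_le_of_le_one_left (abs_nonneg _) h1
      have h7 : (ε * f x) ^ 2 * Real.exp |ε * f x| ≤ ε ^ 2 * (f x ^ 2 * Real.exp |f x|) := by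
        rw [mul_pow, mul_assoc]
        gcongr
      linarith [(abs_le.1 (h2.trans h7)).2]
    have e1 : Integrable (fun x => 1 + ε * f x) ν := (integrable_const _).add (hif.const_mul _)
    calc ∫ x, Real.exp (ε * f x) ∂ν
        ≤ ∫ x, (1 + ε * f x + ε ^ 2 * (f x ^ 2 * Real.exp |f x|)) ∂ν :=
          integral_mono ((h.const_mul ε).integrable_exp ν) (e1.add (him.const_mul _)) hpt
      _ = 1 + ε * ∫ x, f x ∂ν + ε ^ 2 * M := by
          rw [integral_add e1 (him.const_mul _), integral_add (integrable_const _)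
            (hif.const_mul _), integral_const_mul, integral_const_mul, ← hM]
          simp
      _ ≤ _ := by
          linarith [Real.add_one_le_exp (ε * ∫ x, f x ∂ν + ε ^ 2 * M)]
  have hj : ∀ j : ℕ, ∫ x, Real.exp (f x) ∂ν
      ≤ Real.exp (κ / 2 + ∫ x, f x ∂ν + (1 / 2) ^ j * M) := by
    intro j
    have hε0 : (0 : ℝ) ≤ (1 / 2) ^ j := by positivity
    have hε1 : ((1 : ℝ) / 2) ^ j ≤ 1 := pow_le_one₀ (by norm_num) (by norm_num)
    have e2 : (2 : ℝ) ^ j * (1 / 2) ^ j = 1 := by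
      rw [← mul_pow]; norm_num
    calc ∫ x, Real.exp (f x) ∂ν
        ≤ Real.exp (κ / 2 * (1 - (1 / 2) ^ j))
          * (∫ x, Real.exp ((1 / 2) ^ j * f x) ∂ν) ^ (2 ^ j) := hiter j
      _ ≤ Real.exp (κ / 2)
          * (Real.exp ((1 / 2) ^ j * ∫ x, f x ∂ν + ((1 / 2) ^ j) ^ 2 * M)) ^ (2 ^ j) := by
          refine mul_le_mul (Real.exp_le_exp.2 ?_) (pow_le_pow_left₀
            (integral_nonneg fun x => (Real.exp_pos _).le) (hsmall _ hε0 hε1) _)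
            (pow_nonneg (integral_nonneg fun x => (Real.exp_pos _).le) _) (Real.exp_pos _).le
          have : 0 ≤ κ / 2 * (1 / 2) ^ j := by positivity
          linarith
      _ = _ := by
          rw [← Real.exp_nat_mul, ← Real.exp_add]
          congr 1
          push_cast
          linear_combination (∫ x, f x ∂ν + (1 / 2) ^ j * M) * e2
  have hlim : Filter.Tendsto (fun j : ℕ => Real.exp (κ / 2 + ∫ x, f x ∂ν + (1 / 2) ^ j * M))
      Filter.atTop (nhds (Real.exp (κ / 2 + ∫ x, f x ∂ν + 0 * M))) :=
    (Real.continuous_exp.tendsto _).comp (((tendsto_pow_atTop_nhds_zero_of_lt_one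
      (by norm_num) (by norm_num)).mul_const M).const_add _)
  rw [zero_mul, add_zero] at hlim
  exact ge_of_tendsto' hlim hj

end Gaussian

end SmoothAlongLines

end Concentration

/-! ### Smoothed norms and smoothed maxima -/

section Smoothing

theorem smoothAlongLines_clm {V : Type*} [NormedAddCommGroup V] [NormedSpace ℝ V]
    (L : V →L[ℝ] ℝ) :
    SmoothAlongLines (fun x => L x) (fun _ v => L v) (fun _ _ => 0) (fun _ _ => 0) ‖L‖ where
  nonneg := norm_nonneg L
  deriv1 x v t := by
    have h := (((hasDerivAt_id t).mul_const (L v)).const_add (L x))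
    simpa using h
  deriv2 x v t := hasDerivAt_const t (L v)
  deriv3 x v t := hasDerivAt_const t (0 : ℝ)
  bound1 x v := L.le_opNorm v
  bound2 x v := by simpa using mul_nonneg (norm_nonneg L) (by positivity)
  bound3 x v := by simpa using mul_nonneg (norm_nonneg L) (by positivity)
  cont1 x := L.continuous
  cont2 x := continuous_const

section SmoothNorm

variable {H : Type*} [NormedAddCommGroup H] [InnerProductSpace ℝ H]

/-- A smooth approximation of the norm, within `η` of it. -/
noncomputable def smoothNorm (η : ℝ) (x : H) : ℝ := √(‖x‖ ^ 2 + η ^ 2)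

/-- The directional derivative of `smoothNorm η`. -/
noncomputable def smoothNormDeriv (η : ℝ) (x v : H) : ℝ := inner ℝ x v / smoothNorm η x

/-- The second directional derivative of `smoothNorm η`. -/
noncomputable def smoothNormDeriv2 (η : ℝ) (x v : H) : ℝ :=
  (‖v‖ ^ 2 - smoothNormDeriv η x v ^ 2) / smoothNorm η x

variable {η : ℝ}

theorem smoothNorm_sq (η : ℝ) (x : H) : smoothNorm η x ^ 2 = ‖x‖ ^ 2 + η ^ 2 :=
  Real.sq_sqrt (by positivity)

theorem smoothNorm_pos (hη : 0 < η) (x : H) : 0 < smoothNorm η x :=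
  Real.sqrt_pos.2 (by positivity)

theorem le_smoothNorm (η : ℝ) (x : H) : η ≤ smoothNorm η x :=
  Real.le_sqrt_of_sq_le (by nlinarith [norm_nonneg x])

theorem norm_le_smoothNorm (η : ℝ) (x : H) : ‖x‖ ≤ smoothNorm η x :=
  Real.le_sqrt_of_sq_le (by nlinarith)

theorem smoothNorm_le (hη : 0 ≤ η) (x : H) : smoothNorm η x ≤ ‖x‖ + η :=
  Real.sqrt_le_iff.2 ⟨by positivity, by nlinarith [norm_nonneg x, mul_nonneg (norm_nonneg x) hη]⟩

theorem abs_smoothNormDeriv_le (hη : 0 < η) (x v : H) : |smoothNormDeriv η x v| ≤ ‖v‖ := by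
  have hr := smoothNorm_pos hη x
  rw [smoothNormDeriv, abs_div, abs_of_pos hr, div_le_iff₀ hr, mul_comm]
  exact (abs_real_inner_le_norm x v).trans
    (mul_le_mul_of_nonneg_right (norm_le_smoothNorm η x) (norm_nonneg v))

theorem abs_smoothNormDeriv2_le (hη : 0 < η) (x v : H) :
    |smoothNormDeriv2 η x v| ≤ 1 / η * ‖v‖ ^ 2 := by
  have hr := smoothNorm_pos hη x
  have h1 := abs_smoothNormDeriv_le hη x v
  have h2 : smoothNormDeriv η x v ^ 2 ≤ ‖v‖ ^ 2 := by
    rw [← sq_abs]; gcongr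
  rw [smoothNormDeriv2, abs_div, abs_of_pos hr, abs_of_nonneg (sub_nonneg.2 h2), one_div,
    inv_mul_eq_div]
  gcongr
  · linarith [sq_nonneg (smoothNormDeriv η x v)]
  · exact le_smoothNorm η x

theorem hasDerivAt_smoothNorm (hη : 0 < η) (x v : H) (t : ℝ) :
    HasDerivAt (fun t : ℝ => smoothNorm η (x + t • v)) (smoothNormDeriv η (x + t • v) v) t := by
  have hr := smoothNorm_pos hη (x + t • v)
  have hl : HasDerivAt (fun t : ℝ => x + t • v) v t := by
    simpa using ((hasDerivAt_id t).smul_const v).const_add x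
  have h1 := (hl.norm_sq.add_const (η ^ 2)).sqrt (by positivity)
  refine h1.congr_deriv ?_
  rw [smoothNormDeriv, mul_div_mul_left _ _ two_ne_zero]
  rfl

theorem hasDerivAt_smoothNormDeriv (hη : 0 < η) (x v : H) (t : ℝ) :
    HasDerivAt (fun t : ℝ => smoothNormDeriv η (x + t • v) v)
      (smoothNormDeriv2 η (x + t • v) v) t := by
  have hr := smoothNorm_pos hη (x + t • v)
  have hl : HasDerivAt (fun t : ℝ => inner ℝ (x + t • v) v) (‖v‖ ^ 2) t := by
    have := ((hasDerivAt_id t).mul_const (‖v‖ ^ 2)).const_add (inner ℝ x v)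
    simpa [inner_add_left, inner_smul_left] using this
  refine (hl.div (hasDerivAt_smoothNorm hη x v t) hr.ne').congr_deriv ?_
  rw [smoothNormDeriv2, smoothNormDeriv]
  field_simp

theorem smoothAlongLines_smoothNorm (hη : 0 < η) :
    SmoothAlongLines (smoothNorm η : H → ℝ) (smoothNormDeriv η) (smoothNormDeriv2 η)
      (fun x v => -3 * smoothNormDeriv η x v * smoothNormDeriv2 η x v / smoothNorm η x)
      (1 + 1 / η + 3 / η ^ 2) where
  nonneg := by positivity
  deriv1 := hasDerivAt_smoothNorm hη
  deriv2 := hasDerivAt_smoothNormDeriv hη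
  deriv3 x v t := by
    have hr := smoothNorm_pos hη (x + t • v)
    have h1 := hasDerivAt_smoothNormDeriv hη x v t
    refine (((h1.pow 2).const_sub (‖v‖ ^ 2)).div
      (hasDerivAt_smoothNorm hη x v t) hr.ne').congr_deriv ?_
    simp only [smoothNormDeriv2]
    field_simp
    simp
    ring
  bound1 x v := by
    have h1 := abs_smoothNormDeriv_le hη x v
    have : 0 ≤ (1 / η + 3 / η ^ 2) * ‖v‖ := by positivity
    linarith
  bound2 x v := by
    have h1 := abs_smoothNormDeriv2_le hη x v
    have : 0 ≤ (1 + 3 / η ^ 2) * ‖v‖ ^ 2 := by positivity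
    linarith
  bound3 x v := by
    have hr := smoothNorm_pos hη x
    have h1 := abs_smoothNormDeriv_le hη x v
    have h2 := abs_smoothNormDeriv2_le hη x v
    have h3 := le_smoothNorm η x
    rw [abs_div, abs_of_pos hr, abs_mul, abs_mul, abs_neg, abs_of_pos (by norm_num : (0 : ℝ) < 3)]
    calc 3 * |smoothNormDeriv η x v| * |smoothNormDeriv2 η x v| / smoothNorm η x
        ≤ 3 * ‖v‖ * (1 / η * ‖v‖ ^ 2) / η := by gcongr
      _ = 3 / η ^ 2 * ‖v‖ ^ 3 := by field_simp
      _ ≤ _ := by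
        have : 0 ≤ (1 + 1 / η) * ‖v‖ ^ 3 := by positivity
        linarith
  cont1 x := by unfold smoothNormDeriv; fun_prop
  cont2 x := by unfold smoothNormDeriv2 smoothNormDeriv; fun_prop

end SmoothNorm

section SmoothMax

variable {ι : Type*} [Fintype ι] [Nonempty ι]

/-- The smoothed maximum `k⁻¹ log ∑ exp (k aᵢ)` of finitely many numbers. -/
noncomputable def smoothMax (k : ℝ) (a : ι → ℝ) : ℝ := 1 / k * Real.log (∑ i, Real.exp (k * a i))

/-- The weights `exp (k aᵢ) / ∑ exp (k aⱼ)`, the partial derivatives of `smoothMax k`. -/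
noncomputable def gibbsWeight (k : ℝ) (a : ι → ℝ) (i : ι) : ℝ :=
  Real.exp (k * a i) / ∑ j, Real.exp (k * a j)

theorem sum_exp_pos (a : ι → ℝ) : 0 < ∑ i, Real.exp (a i) :=
  Finset.sum_pos (fun _ _ => Real.exp_pos _) Finset.univ_nonempty

theorem gibbsWeight_nonneg (k : ℝ) (a : ι → ℝ) (i : ι) : 0 ≤ gibbsWeight k a i :=
  div_nonneg (Real.exp_pos _).le (sum_exp_pos _).le

theorem sum_gibbsWeight (k : ℝ) (a : ι → ℝ) : ∑ i, gibbsWeight k a i = 1 := by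
  simp only [gibbsWeight]
  rw [← Finset.sum_div, div_self (sum_exp_pos _).ne']

theorem le_smoothMax {k : ℝ} (hk : 0 < k) (a : ι → ℝ) (i : ι) : a i ≤ smoothMax k a := by
  rw [smoothMax, one_div, inv_mul_eq_div, le_div_iff₀ hk, Real.le_log_iff_exp_le (sum_exp_pos _),
    mul_comm]
  exact Finset.single_le_sum (f := fun i => Real.exp (k * a i)) (fun _ _ => (Real.exp_pos _).le)
    (Finset.mem_univ i)

theorem smoothMax_le {k : ℝ} (hk : 0 < k) {a : ι → ℝ} {m : ℝ} (h : ∀ i, a i ≤ m) :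
    smoothMax k a ≤ m + Real.log (Fintype.card ι) / k := by
  have hcard : (0 : ℝ) < Fintype.card ι := Nat.cast_pos.2 Fintype.card_pos
  have h1 : ∑ i, Real.exp (k * a i) ≤ Fintype.card ι * Real.exp (k * m) := by
    have := Finset.sum_le_card_nsmul Finset.univ (fun i => Real.exp (k * a i)) (Real.exp (k * m))
      fun i _ => Real.exp_le_exp.2 (mul_le_mul_of_nonneg_left (h i) hk.le)
    simpa using this
  have h2 := Real.log_le_log (sum_exp_pos fun i => k * a i) h1
  rw [Real.log_mul hcard.ne' (Real.exp_pos _).ne', Real.log_exp] at h2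
  rw [smoothMax, one_div, inv_mul_eq_div, div_le_iff₀ hk, add_mul, div_mul_cancel₀ _ hk.ne']
  linarith

theorem abs_sum_le_of_abs_le_weight {p a : ι → ℝ} {M : ℝ} (hp : ∑ i, p i = 1)
    (h : ∀ i, |a i| ≤ p i * M) : |∑ i, a i| ≤ M :=
  calc |∑ i, a i| ≤ ∑ i, |a i| := Finset.abs_sum_le_sum_abs _ _
    _ ≤ ∑ i, p i * M := Finset.sum_le_sum fun i _ => h i
    _ = M := by rw [← Finset.sum_mul, hp, one_mul]

variable {V : Type*} [NormedAddCommGroup V] [NormedSpace ℝ V]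

/-- The directional derivative of `smoothMax k` of a family with directional derivatives `d1`. -/
noncomputable def smoothMaxDeriv (k : ℝ) (f : ι → V → ℝ) (d1 : ι → V → V → ℝ) (x v : V) : ℝ :=
  ∑ i, gibbsWeight k (fun j => f j x) i * d1 i x v

/-- The directional derivative of the Gibbs weights. -/
noncomputable def gibbsDeriv (k : ℝ) (f : ι → V → ℝ) (d1 : ι → V → V → ℝ) (i : ι) (x v : V) : ℝ :=
  k * (gibbsWeight k (fun j => f j x) i * (d1 i x v - smoothMaxDeriv k f d1 x v))

/-- The second directional derivative of `smoothMax k` of a family with directional derivatives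
`d1` and `d2`. -/
noncomputable def smoothMaxDeriv2 (k : ℝ) (f : ι → V → ℝ) (d1 d2 : ι → V → V → ℝ) (x v : V) : ℝ :=
  ∑ i, (gibbsDeriv k f d1 i x v * d1 i x v + gibbsWeight k (fun j => f j x) i * d2 i x v)

/-- The second directional derivative of the Gibbs weights. -/
noncomputable def gibbsDeriv2 (k : ℝ) (f : ι → V → ℝ) (d1 d2 : ι → V → V → ℝ) (i : ι) (x v : V) :
    ℝ :=
  k * (gibbsDeriv k f d1 i x v * (d1 i x v - smoothMaxDeriv k f d1 x v)
    + gibbsWeight k (fun j => f j x) i * (d2 i x v - smoothMaxDeriv2 k f d1 d2 x v))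

/-- The third directional derivative of `smoothMax k` of a family with directional derivatives
`d1`, `d2` and `d3`. -/
noncomputable def smoothMaxDeriv3 (k : ℝ) (f : ι → V → ℝ) (d1 d2 d3 : ι → V → V → ℝ) (x v : V) :
    ℝ :=
  ∑ i, ((gibbsDeriv2 k f d1 d2 i x v * d1 i x v + gibbsDeriv k f d1 i x v * d2 i x v)
    + (gibbsDeriv k f d1 i x v * d2 i x v + gibbsWeight k (fun j => f j x) i * d3 i x v))

variable {f : ι → V → ℝ} {d1 d2 d3 : ι → V → V → ℝ} {C : ℝ}

theorem hasDerivAt_sum_exp (h : ∀ i, SmoothAlongLines (f i) (d1 i) (d2 i) (d3 i) C) (k : ℝ)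
    (x v : V) (t : ℝ) :
    HasDerivAt (fun t : ℝ => ∑ i, Real.exp (k * f i (x + t • v)))
      (∑ i, Real.exp (k * f i (x + t • v)) * (k * d1 i (x + t • v) v)) t :=
  HasDerivAt.fun_sum fun i _ => (((h i).deriv1 x v t).const_mul k).exp

theorem hasDerivAt_smoothMax (h : ∀ i, SmoothAlongLines (f i) (d1 i) (d2 i) (d3 i) C) {k : ℝ}
    (hk : 0 < k) (x v : V) (t : ℝ) :
    HasDerivAt (fun t : ℝ => smoothMax k (fun i => f i (x + t • v)))
      (smoothMaxDeriv k f d1 (x + t • v) v) t := by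
  have hS := (sum_exp_pos fun i => k * f i (x + t • v)).ne'
  refine (((hasDerivAt_sum_exp h k x v t).log hS).const_mul (1 / k)).congr_deriv ?_
  simp only [smoothMaxDeriv, gibbsWeight]
  rw [Finset.sum_div, Finset.mul_sum]
  refine Finset.sum_congr rfl fun i _ => ?_
  field_simp

theorem hasDerivAt_gibbsWeight (h : ∀ i, SmoothAlongLines (f i) (d1 i) (d2 i) (d3 i) C) (k : ℝ)
    (x v : V) (i : ι) (t : ℝ) :
    HasDerivAt (fun t : ℝ => gibbsWeight k (fun j => f j (x + t • v)) i)
      (gibbsDeriv k f d1 i (x + t • v) v) t := by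
  have hS := (sum_exp_pos fun i => k * f i (x + t • v)).ne'
  refine (((((h i).deriv1 x v t).const_mul k).exp).div
    (hasDerivAt_sum_exp h k x v t) hS).congr_deriv ?_
  simp only [gibbsDeriv, smoothMaxDeriv, gibbsWeight, div_mul_eq_mul_div]
  rw [← Finset.sum_div]
  have e : ∑ i, Real.exp (k * f i (x + t • v)) * (k * d1 i (x + t • v) v)
      = k * ∑ i, Real.exp (k * f i (x + t • v)) * d1 i (x + t • v) v := by
    rw [Finset.mul_sum]
    exact Finset.sum_congr rfl fun i _ => by ring
  rw [e]
  field_simp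

theorem hasDerivAt_smoothMaxDeriv (h : ∀ i, SmoothAlongLines (f i) (d1 i) (d2 i) (d3 i) C) (k : ℝ)
    (x v : V) (t : ℝ) :
    HasDerivAt (fun t : ℝ => smoothMaxDeriv k f d1 (x + t • v) v)
      (smoothMaxDeriv2 k f d1 d2 (x + t • v) v) t :=
  HasDerivAt.fun_sum fun i _ => (hasDerivAt_gibbsWeight h k x v i t).mul ((h i).deriv2 x v t)

theorem hasDerivAt_gibbsDeriv (h : ∀ i, SmoothAlongLines (f i) (d1 i) (d2 i) (d3 i) C) (k : ℝ)
    (x v : V) (i : ι) (t : ℝ) :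
    HasDerivAt (fun t : ℝ => gibbsDeriv k f d1 i (x + t • v) v)
      (gibbsDeriv2 k f d1 d2 i (x + t • v) v) t :=
  ((hasDerivAt_gibbsWeight h k x v i t).mul
    (((h i).deriv2 x v t).sub (hasDerivAt_smoothMaxDeriv h k x v t))).const_mul k

theorem hasDerivAt_smoothMaxDeriv2 (h : ∀ i, SmoothAlongLines (f i) (d1 i) (d2 i) (d3 i) C) (k : ℝ)
    (x v : V) (t : ℝ) :
    HasDerivAt (fun t : ℝ => smoothMaxDeriv2 k f d1 d2 (x + t • v) v)
      (smoothMaxDeriv3 k f d1 d2 d3 (x + t • v) v) t :=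
  HasDerivAt.fun_sum fun i _ =>
    ((hasDerivAt_gibbsDeriv h k x v i t).mul ((h i).deriv2 x v t)).add
      ((hasDerivAt_gibbsWeight h k x v i t).mul ((h i).deriv3 x v t))

theorem smoothAlongLines_smoothMax (h : ∀ i, SmoothAlongLines (f i) (d1 i) (d2 i) (d3 i) C) {k : ℝ}
    (hk : 0 < k) :
    ∃ C', SmoothAlongLines (fun x => smoothMax k (fun i => f i x)) (smoothMaxDeriv k f d1)
      (smoothMaxDeriv2 k f d1 d2) (smoothMaxDeriv3 k f d1 d2 d3) C' := by
  obtain ⟨i₀⟩ := ‹Nonempty ι›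
  have hC := (h i₀).nonneg
  have : Nonempty ι := ⟨i₀⟩
  have hp := fun (x : V) i => gibbsWeight_nonneg k (fun j => f j x) i
  have hs := fun x : V => sum_gibbsWeight k (fun j => f j x)
  have b1 : ∀ x v, |smoothMaxDeriv k f d1 x v| ≤ C * ‖v‖ := fun x v =>
    abs_sum_le_of_abs_le_weight (hs x) fun i => by
      rw [abs_mul, abs_of_nonneg (hp x i)]
      exact mul_le_mul_of_nonneg_left ((h i).bound1 x v) (hp x i)
  have c1 : ∀ i x v, |d1 i x v - smoothMaxDeriv k f d1 x v| ≤ 2 * C * ‖v‖ := fun i x v =>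
    (abs_sub _ _).trans (by linarith [(h i).bound1 x v, b1 x v])
  have w1 : ∀ i x v, |gibbsDeriv k f d1 i x v|
      ≤ gibbsWeight k (fun j => f j x) i * (2 * k * C * ‖v‖) := fun i x v => by
    rw [gibbsDeriv, abs_mul, abs_mul, abs_of_pos hk, abs_of_nonneg (hp x i)]
    calc k * (gibbsWeight k (fun j => f j x) i * |d1 i x v - smoothMaxDeriv k f d1 x v|)
        ≤ k * (gibbsWeight k (fun j => f j x) i * (2 * C * ‖v‖)) := by
          gcongr
          · exact hp x i
          · exact c1 i x v
      _ = _ := by ring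
  set C2 := 2 * k * C * C + C with hC2
  have hC20 : 0 ≤ C2 := by positivity
  have b2 : ∀ x v, |smoothMaxDeriv2 k f d1 d2 x v| ≤ C2 * ‖v‖ ^ 2 := fun x v =>
    abs_sum_le_of_abs_le_weight (hs x) fun i => by
      have hp' := hp x i
      refine (abs_add_le _ _).trans ?_
      rw [abs_mul, abs_mul, abs_of_nonneg hp']
      calc _ ≤ gibbsWeight k (fun j => f j x) i * (2 * k * C * ‖v‖) * (C * ‖v‖)
            + gibbsWeight k (fun j => f j x) i * (C * ‖v‖ ^ 2) := by
            gcongr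
            · exact w1 i x v
            · exact (h i).bound1 x v
            · exact (h i).bound2 x v
        _ = _ := by rw [hC2]; ring
  set C3 := k * (2 * k * C * (2 * C) + (C + C2)) with hC3
  have hC30 : 0 ≤ C3 := by positivity
  have w2 : ∀ i x v, |gibbsDeriv2 k f d1 d2 i x v|
      ≤ gibbsWeight k (fun j => f j x) i * (C3 * ‖v‖ ^ 2) := fun i x v => by
    have hp' := hp x i
    have c2 : |d2 i x v - smoothMaxDeriv2 k f d1 d2 x v| ≤ (C + C2) * ‖v‖ ^ 2 :=
      (abs_sub _ _).trans (by linarith [(h i).bound2 x v, b2 x v])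
    rw [gibbsDeriv2, abs_mul, abs_of_pos hk]
    calc _ ≤ k * (gibbsWeight k (fun j => f j x) i * (2 * k * C * ‖v‖) * (2 * C * ‖v‖)
          + gibbsWeight k (fun j => f j x) i * ((C + C2) * ‖v‖ ^ 2)) := by
          gcongr
          refine (abs_add_le _ _).trans ?_
          rw [abs_mul, abs_mul, abs_of_nonneg hp']
          gcongr
          · exact w1 i x v
          · exact c1 i x v
      _ = _ := by rw [hC3]; ring
  set C4 := C3 * C + 2 * (2 * k * C * C) + C with hC4
  have hC40 : 0 ≤ C4 := by positivity
  have b3 : ∀ x v, |smoothMaxDeriv3 k f d1 d2 d3 x v| ≤ C4 * ‖v‖ ^ 3 := fun x v =>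
    abs_sum_le_of_abs_le_weight (hs x) fun i => by
      have hp' := hp x i
      have m1 : |gibbsDeriv2 k f d1 d2 i x v * d1 i x v|
          ≤ gibbsWeight k (fun j => f j x) i * (C3 * ‖v‖ ^ 2) * (C * ‖v‖) := by
        rw [abs_mul]
        gcongr
        · exact w2 i x v
        · exact (h i).bound1 x v
      have m2 : |gibbsDeriv k f d1 i x v * d2 i x v|
          ≤ gibbsWeight k (fun j => f j x) i * (2 * k * C * ‖v‖) * (C * ‖v‖ ^ 2) := by
        rw [abs_mul]
        gcongr
        · exact w1 i x v
        · exact (h i).bound2 x v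
      have m3 : |gibbsWeight k (fun j => f j x) i * d3 i x v|
          ≤ gibbsWeight k (fun j => f j x) i * (C * ‖v‖ ^ 3) := by
        rw [abs_mul, abs_of_nonneg hp']
        gcongr
        exact (h i).bound3 x v
      calc _ ≤ (gibbsWeight k (fun j => f j x) i * (C3 * ‖v‖ ^ 2) * (C * ‖v‖)
              + gibbsWeight k (fun j => f j x) i * (2 * k * C * ‖v‖) * (C * ‖v‖ ^ 2))
            + (gibbsWeight k (fun j => f j x) i * (2 * k * C * ‖v‖) * (C * ‖v‖ ^ 2)
              + gibbsWeight k (fun j => f j x) i * (C * ‖v‖ ^ 3)) :=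
            (abs_add_le _ _).trans (add_le_add
              ((abs_add_le _ _).trans (add_le_add m1 m2))
              ((abs_add_le _ _).trans (add_le_add m2 m3)))
        _ = _ := by rw [hC4]; ring
  have cc1 := fun i x => (h i).cont1 x
  have cc2 := fun i x => (h i).cont2 x
  have hcont1 : ∀ x, Continuous (smoothMaxDeriv k f d1 x) := fun x => by
    unfold smoothMaxDeriv
    fun_prop
  refine ⟨C + C2 + C4, by positivity, hasDerivAt_smoothMax h hk, hasDerivAt_smoothMaxDeriv h k,
    hasDerivAt_smoothMaxDeriv2 h k, fun x v => ?_, fun x v => ?_, fun x v => ?_, hcont1,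
    fun x => ?_⟩
  · have : 0 ≤ (C2 + C4) * ‖v‖ := by positivity
    linarith [b1 x v]
  · have : 0 ≤ (C + C4) * ‖v‖ ^ 2 := by positivity
    linarith [b2 x v]
  · have : 0 ≤ (C + C2) * ‖v‖ ^ 3 := by positivity
    linarith [b3 x v]
  · have := hcont1 x
    unfold smoothMaxDeriv2 gibbsDeriv
    fun_prop

/-- The second derivative of a smoothed maximum: the average of the second derivatives plus `k`
times the variance of the first derivatives, under the Gibbs weights. -/
theorem smoothMaxDeriv2_eq (k : ℝ) (f : ι → V → ℝ) (d1 d2 : ι → V → V → ℝ) (x v : V) :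
    smoothMaxDeriv2 k f d1 d2 x v
      = ∑ i, gibbsWeight k (fun j => f j x) i * (d2 i x v + k * d1 i x v ^ 2)
        - k * smoothMaxDeriv k f d1 x v ^ 2 := by
  have e : k * smoothMaxDeriv k f d1 x v ^ 2
      = ∑ i, gibbsWeight k (fun j => f j x) i * d1 i x v * (k * smoothMaxDeriv k f d1 x v) := by
    rw [← Finset.sum_mul]
    change _ = smoothMaxDeriv k f d1 x v * _
    ring
  rw [e, ← Finset.sum_sub_distrib, smoothMaxDeriv2]
  refine Finset.sum_congr rfl fun i _ => ?_
  rw [gibbsDeriv]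
  ring

end SmoothMax

end Smoothing

/-! ### Gordon's inequality at the level of exponential moments -/

section Moments

variable {E : Type*} [NormedAddCommGroup E] [InnerProductSpace ℝ E] [FiniteDimensional ℝ E]
  [MeasurableSpace E] [BorelSpace E]

theorem integral_inner_stdGaussian (a : E) : ∫ x, inner ℝ a x ∂(stdGaussian E) = 0 :=
  integral_strongDual_stdGaussian (innerSL ℝ a)

theorem integral_inner_sq_stdGaussian (a : E) :
    ∫ x, (inner ℝ a x) ^ 2 ∂(stdGaussian E) = ‖a‖ ^ 2 := by
  have h := variance_dual_stdGaussian (innerSL ℝ a)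
  rw [variance_of_integral_eq_zero (by fun_prop) (integral_strongDual_stdGaussian _)] at h
  simpa [innerSL_apply_norm] using h

theorem integrable_inner_stdGaussian (a : E) :
    Integrable (fun x => inner ℝ a x) (stdGaussian E) :=
  IsGaussian.integrable_dual (stdGaussian E) (innerSL ℝ a)

theorem integrable_inner_sq_stdGaussian (a : E) :
    Integrable (fun x => (inner ℝ a x) ^ 2) (stdGaussian E) :=
  (IsGaussian.memLp_dual (stdGaussian E) (innerSL ℝ a) 2 (by simp)).integrable_sq

theorem integrable_norm_sq_stdGaussian : Integrable (fun x : E => ‖x‖ ^ 2) (stdGaussian E) := by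
  simpa using integrable_norm_pow_mul_exp (stdGaussian E) 2 0

theorem integrable_norm_stdGaussian : Integrable (fun x : E => ‖x‖) (stdGaussian E) := by
  simpa using integrable_norm_pow_mul_exp (stdGaussian E) 1 0

theorem integral_id_stdGaussian_eq_zero : (stdGaussian E)[id] = 0 := by
  simp

theorem integral_norm_sq_stdGaussian (n : ℕ) :
    ∫ x, ‖x‖ ^ 2 ∂(stdGaussian (EuclideanSpace ℝ (Fin n))) = n := by
  have h : ∀ x : EuclideanSpace ℝ (Fin n),
      ‖x‖ ^ 2 = ∑ i, (inner ℝ (EuclideanSpace.single i (1 : ℝ)) x) ^ 2 := fun x => by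
    rw [EuclideanSpace.real_norm_sq_eq]
    simp [EuclideanSpace.inner_single_left]
  simp only [h]
  rw [integral_finsetSum _ fun i _ => integrable_inner_sq_stdGaussian _]
  simp [integral_inner_sq_stdGaussian]

variable {F : Type*} [NormedAddCommGroup F] [InnerProductSpace ℝ F] [FiniteDimensional ℝ F]
  [MeasurableSpace F] [BorelSpace F]

theorem integral_inner_add_inner_sq (a : E) (b : F) :
    ∫ v : E × F, (inner ℝ a v.1 + inner ℝ b v.2) ^ 2 ∂((stdGaussian E).prod (stdGaussian F))
      = ‖a‖ ^ 2 + ‖b‖ ^ 2 := by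
  have i1 : Integrable (fun v : E × F => (inner ℝ a v.1) ^ 2)
      ((stdGaussian E).prod (stdGaussian F)) :=
    (integrable_inner_sq_stdGaussian a).comp_fst _
  have i2 : Integrable (fun v : E × F => (inner ℝ b v.2) ^ 2)
      ((stdGaussian E).prod (stdGaussian F)) :=
    (integrable_inner_sq_stdGaussian b).comp_snd _
  have i3 : Integrable (fun v : E × F => (inner ℝ a v.1) * (inner ℝ b v.2))
      ((stdGaussian E).prod (stdGaussian F)) :=
    (integrable_inner_stdGaussian a).mul_prod (integrable_inner_stdGaussian b)
  have i12 : Integrable (fun v : E × F => (inner ℝ a v.1) ^ 2 + (inner ℝ b v.2) ^ 2)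
      ((stdGaussian E).prod (stdGaussian F)) := i1.add i2
  have e : ∀ v : E × F, (inner ℝ a v.1 + inner ℝ b v.2) ^ 2
      = ((inner ℝ a v.1) ^ 2 + (inner ℝ b v.2) ^ 2)
        + 2 * ((inner ℝ a v.1) * (inner ℝ b v.2)) := fun v => by ring
  simp only [e]
  rw [integral_add i12 (i3.const_mul _), integral_add i1 i2, integral_const_mul,
    integral_prod_mul (fun x => inner ℝ a x) (fun x => inner ℝ b x), integral_inner_stdGaussian,
    integral_fun_fst (fun x => (inner ℝ a x) ^ 2), integral_fun_snd (fun x => (inner ℝ b x) ^ 2),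
    integral_inner_sq_stdGaussian, integral_inner_sq_stdGaussian]
  simp

end Moments

section Bilinear

variable {n p : ℕ}

/-- The matrix-vector product `G ↦ G z`, where the `n × p` matrix `G` is regarded as a vector of
`ℝ ^ (n * p)`. -/
noncomputable def matVec (z : EuclideanSpace ℝ (Fin p)) :
    EuclideanSpace ℝ (Fin n × Fin p) →L[ℝ] EuclideanSpace ℝ (Fin n) :=
  LinearMap.toContinuousLinearMap
    { toFun := fun G => WithLp.toLp 2 fun i => ∑ j, G (i, j) * z j
      map_add' := fun G G' => by
        ext i
        simp [add_mul, Finset.sum_add_distrib]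
      map_smul' := fun c G => by
        ext i
        simp [Finset.mul_sum, mul_assoc] }

/-- The rank one matrix `a zᵀ`, regarded as a vector of `ℝ ^ (n * p)`. -/
noncomputable def outerVec (a : EuclideanSpace ℝ (Fin n)) (z : EuclideanSpace ℝ (Fin p)) :
    EuclideanSpace ℝ (Fin n × Fin p) :=
  WithLp.toLp 2 fun ij => a ij.1 * z ij.2

theorem matVec_apply (z : EuclideanSpace ℝ (Fin p)) (G : EuclideanSpace ℝ (Fin n × Fin p))
    (i : Fin n) : matVec z G i = ∑ j, G (i, j) * z j := rfl

theorem continuous_matVec (G : EuclideanSpace ℝ (Fin n × Fin p)) :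
    Continuous fun z : EuclideanSpace ℝ (Fin p) => matVec z G := by
  change Continuous fun z : EuclideanSpace ℝ (Fin p) =>
    WithLp.toLp 2 fun i : Fin n => ∑ j, G (i, j) * z j
  fun_prop

theorem inner_matVec (a : EuclideanSpace ℝ (Fin n)) (z : EuclideanSpace ℝ (Fin p))
    (G : EuclideanSpace ℝ (Fin n × Fin p)) :
    inner ℝ a (matVec z G) = inner ℝ (outerVec a z) G := by
  simp only [PiLp.inner_apply, matVec_apply, outerVec, RCLike.inner_apply, conj_trivial,
    Fintype.sum_prod_type, Finset.sum_mul]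
  exact Finset.sum_congr rfl fun i _ => Finset.sum_congr rfl fun j _ => by ring

theorem inner_outerVec (a b : EuclideanSpace ℝ (Fin n)) (z w : EuclideanSpace ℝ (Fin p)) :
    inner ℝ (outerVec a z) (outerVec b w) = inner ℝ a b * inner ℝ z w := by
  simp only [PiLp.inner_apply, outerVec, RCLike.inner_apply, conj_trivial,
    Fintype.sum_prod_type, Finset.sum_mul_sum]
  exact Finset.sum_congr rfl fun i _ => Finset.sum_congr rfl fun j _ => by ring

theorem norm_outerVec_sq (a : EuclideanSpace ℝ (Fin n)) (z : EuclideanSpace ℝ (Fin p)) :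
    ‖outerVec a z‖ ^ 2 = ‖a‖ ^ 2 * ‖z‖ ^ 2 := by
  rw [← real_inner_self_eq_norm_sq, inner_outerVec, real_inner_self_eq_norm_sq,
    real_inner_self_eq_norm_sq]

theorem integral_norm_matVec_sq (z : EuclideanSpace ℝ (Fin p)) :
    ∫ G, ‖matVec z G‖ ^ 2 ∂(stdGaussian (EuclideanSpace ℝ (Fin n × Fin p))) = n * ‖z‖ ^ 2 := by
  have h : ∀ G : EuclideanSpace ℝ (Fin n × Fin p), ‖matVec z G‖ ^ 2
      = ∑ i, (inner ℝ (outerVec (EuclideanSpace.single i (1 : ℝ)) z) G) ^ 2 := fun G => by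
    rw [EuclideanSpace.real_norm_sq_eq]
    simp [← inner_matVec, EuclideanSpace.inner_single_left]
  simp only [h]
  rw [integral_finsetSum _ fun i _ => integrable_inner_sq_stdGaussian _]
  simp [integral_inner_sq_stdGaussian, norm_outerVec_sq]

theorem norm_sum_smul_sq {ι E : Type*} [Fintype ι] [NormedAddCommGroup E] [InnerProductSpace ℝ E]
    (q : ι → ℝ) (u : ι → E) :
    ‖∑ i, q i • u i‖ ^ 2 = ∑ i, ∑ j, q i * q j * inner ℝ (u i) (u j) := by
  rw [← real_inner_self_eq_norm_sq, sum_inner]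
  refine Finset.sum_congr rfl fun i _ => ?_
  rw [inner_sum]
  refine Finset.sum_congr rfl fun j _ => ?_
  rw [inner_smul_left, inner_smul_right]
  simp [mul_assoc]

/-- The covariance inequality `∑ pᵢ pⱼ (1 - ⟪aᵢ, aⱼ⟫) (1 - ⟪zᵢ, zⱼ⟫) ≥ 0` behind Gordon's
comparison of `⟪a, G z⟫` with `⟪a, h⟫ + ⟪z, g⟫`. -/
theorem norm_sum_sq_add_norm_sum_sq_le {ι : Type*} [Fintype ι] {q : ι → ℝ} (hq : ∀ i, 0 ≤ q i)
    (hq1 : ∑ i, q i = 1) {a : ι → EuclideanSpace ℝ (Fin n)} (ha : ∀ i, ‖a i‖ ≤ 1)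
    {z : ι → EuclideanSpace ℝ (Fin p)} (hz : ∀ i, ‖z i‖ ≤ 1) :
    ‖∑ i, q i • a i‖ ^ 2 + ‖∑ i, q i • z i‖ ^ 2
      ≤ ‖∑ i, q i • outerVec (a i) (z i)‖ ^ 2 + 1 := by
  have h1 : (1 : ℝ) = ∑ i, ∑ j, q i * q j := by
    rw [← Finset.sum_mul_sum, hq1, one_mul]
  have h2 : 0 ≤ ∑ i, ∑ j, q i * q j * ((1 - inner ℝ (a i) (a j)) * (1 - inner ℝ (z i) (z j))) := by
    refine Finset.sum_nonneg fun i _ => Finset.sum_nonneg fun j _ => ?_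
    have e1 : inner ℝ (a i) (a j) ≤ 1 := (real_inner_le_norm _ _).trans
      (mul_le_one₀ (ha i) (norm_nonneg _) (ha j))
    have e2 : inner ℝ (z i) (z j) ≤ 1 := (real_inner_le_norm _ _).trans
      (mul_le_one₀ (hz i) (norm_nonneg _) (hz j))
    exact mul_nonneg (mul_nonneg (hq i) (hq j)) (mul_nonneg (by linarith) (by linarith))
  have h3 : ∑ i, ∑ j, q i * q j * ((1 - inner ℝ (a i) (a j)) * (1 - inner ℝ (z i) (z j)))
      = (‖∑ i, q i • outerVec (a i) (z i)‖ ^ 2 + 1)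
        - (‖∑ i, q i • a i‖ ^ 2 + ‖∑ i, q i • z i‖ ^ 2) := by
    rw [norm_sum_smul_sq, norm_sum_smul_sq, norm_sum_smul_sq]
    nth_rewrite 3 [h1]
    simp only [← Finset.sum_add_distrib, ← Finset.sum_sub_distrib]
    refine Finset.sum_congr rfl fun i _ => Finset.sum_congr rfl fun j _ => ?_
    rw [inner_outerVec]
    ring
  linarith

end Bilinear

section Gordon

variable {n p : ℕ}

theorem SmoothAlongLines.mono {V : Type*} [NormedAddCommGroup V] [NormedSpace ℝ V] {f : V → ℝ}
    {d1 d2 d3 : V → V → ℝ} {C C' : ℝ} (h : SmoothAlongLines f d1 d2 d3 C) (hC : C ≤ C') :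
    SmoothAlongLines f d1 d2 d3 C' where
  nonneg := h.nonneg.trans hC
  deriv1 := h.deriv1
  deriv2 := h.deriv2
  deriv3 := h.deriv3
  bound1 x v := (h.bound1 x v).trans (by gcongr)
  bound2 x v := (h.bound2 x v).trans (by gcongr)
  bound3 x v := (h.bound3 x v).trans (by gcongr)
  cont1 := h.cont1
  cont2 := h.cont2

/-- The space of triples `(G, h, g)` made of an `n × p` matrix, a vector of `ℝ ^ n` and a vector of
`ℝ ^ p`. -/
abbrev GordonSpace (n p : ℕ) : Type :=
  EuclideanSpace ℝ (Fin n × Fin p) × (EuclideanSpace ℝ (Fin n) × EuclideanSpace ℝ (Fin p))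

/-- The law of `(G, 0, 0)` with `G` standard Gaussian. -/
noncomputable def matrixLaw (n p : ℕ) : Measure (GordonSpace n p) :=
  (stdGaussian (EuclideanSpace ℝ (Fin n × Fin p))).map (ContinuousLinearMap.inl ℝ
    (EuclideanSpace ℝ (Fin n × Fin p)) (EuclideanSpace ℝ (Fin n) × EuclideanSpace ℝ (Fin p)))

/-- The law of `(0, h, g)` with `h` and `g` independent and standard Gaussian. -/
noncomputable def vectorLaw (n p : ℕ) : Measure (GordonSpace n p) :=
  ((stdGaussian (EuclideanSpace ℝ (Fin n))).prod (stdGaussian (EuclideanSpace ℝ (Fin p)))).map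
    (ContinuousLinearMap.inr ℝ (EuclideanSpace ℝ (Fin n × Fin p))
      (EuclideanSpace ℝ (Fin n) × EuclideanSpace ℝ (Fin p)))

instance : IsGaussian (matrixLaw n p) := by unfold matrixLaw; infer_instance

instance : IsGaussian (vectorLaw n p) := by unfold vectorLaw; infer_instance

theorem integral_id_matrixLaw : (matrixLaw n p)[id] = 0 :=
  SmoothAlongLines.integral_id_map_eq_zero integral_id_stdGaussian_eq_zero _

theorem integral_id_vectorLaw : (vectorLaw n p)[id] = 0 :=
  SmoothAlongLines.integral_id_map_eq_zero (SmoothAlongLines.integral_id_prod_eq_zero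
    integral_id_stdGaussian_eq_zero integral_id_stdGaussian_eq_zero) _

theorem integral_matrixLaw {F : GordonSpace n p → ℝ} (hF : Continuous F) :
    ∫ x, F x ∂(matrixLaw n p)
      = ∫ G, F (G, 0, 0) ∂(stdGaussian (EuclideanSpace ℝ (Fin n × Fin p))) :=
  integral_map (by fun_prop) hF.measurable.aestronglyMeasurable

theorem integral_vectorLaw {F : GordonSpace n p → ℝ} (hF : Continuous F) :
    ∫ x, F x ∂(vectorLaw n p) = ∫ v, F (0, v) ∂((stdGaussian (EuclideanSpace ℝ (Fin n))).prod
      (stdGaussian (EuclideanSpace ℝ (Fin p)))) :=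
  integral_map (by fun_prop) hF.measurable.aestronglyMeasurable

/-- The linear map `(G, h, g) ↦ G z + h`. -/
noncomputable def shiftedMatVec (z : EuclideanSpace ℝ (Fin p)) :
    GordonSpace n p →L[ℝ] EuclideanSpace ℝ (Fin n) :=
  (matVec z).comp (ContinuousLinearMap.fst ℝ _ _)
    + (ContinuousLinearMap.fst ℝ _ _).comp (ContinuousLinearMap.snd ℝ _ _)

/-- The linear functional `(G, h, g) ↦ ⟪z, g⟫`. -/
noncomputable def lastInner (z : EuclideanSpace ℝ (Fin p)) : GordonSpace n p →L[ℝ] ℝ :=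
  (innerSL ℝ z).comp ((ContinuousLinearMap.snd ℝ _ _).comp (ContinuousLinearMap.snd ℝ _ _))

theorem shiftedMatVec_apply (z : EuclideanSpace ℝ (Fin p)) (x : GordonSpace n p) :
    shiftedMatVec z x = matVec z x.1 + x.2.1 := rfl

theorem lastInner_apply (z : EuclideanSpace ℝ (Fin p)) (x : GordonSpace n p) :
    lastInner z x = inner ℝ z x.2.2 := rfl

/-- The function `(G, h, g) ↦ -‖G z + h‖ + ⟪z, g⟫`, with a smoothed norm. On `(G, 0, 0)` it is
`-‖G z‖`, and on `(0, h, g)` it is `-‖h‖ + ⟪z, g⟫`. -/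
noncomputable def gordonFun (η : ℝ) (z : EuclideanSpace ℝ (Fin p)) (x : GordonSpace n p) : ℝ :=
  -1 * smoothNorm η (shiftedMatVec z x) + lastInner z x

/-- The first directional derivative of `gordonFun`. -/
noncomputable def gordonDeriv (η : ℝ) (z : EuclideanSpace ℝ (Fin p)) (x v : GordonSpace n p) : ℝ :=
  -1 * smoothNormDeriv η (shiftedMatVec z x) (shiftedMatVec z v) + lastInner z v

/-- The second directional derivative of `gordonFun`. -/
noncomputable def gordonDeriv2 (η : ℝ) (z : EuclideanSpace ℝ (Fin p)) (x v : GordonSpace n p) :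
    ℝ :=
  -1 * smoothNormDeriv2 η (shiftedMatVec z x) (shiftedMatVec z v) + 0

theorem smoothAlongLines_gordonFun {η : ℝ} (hη : 0 < η) (z : EuclideanSpace ℝ (Fin p)) :
    ∃ d3 C, SmoothAlongLines (gordonFun (n := n) η z) (gordonDeriv η z) (gordonDeriv2 η z) d3 C :=
  ⟨_, _, (((smoothAlongLines_smoothNorm hη).comp_clm (shiftedMatVec z)).const_mul (-1)).add
    (smoothAlongLines_clm (lastInner z))⟩

/-- The gradient of the smoothed norm at `G z + h`. -/
noncomputable def gordonNormal (η : ℝ) (z : EuclideanSpace ℝ (Fin p)) (x : GordonSpace n p) :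
    EuclideanSpace ℝ (Fin n) :=
  (smoothNorm η (shiftedMatVec z x))⁻¹ • shiftedMatVec z x

theorem norm_gordonNormal_le {η : ℝ} (hη : 0 < η) (z : EuclideanSpace ℝ (Fin p))
    (x : GordonSpace n p) : ‖gordonNormal η z x‖ ≤ 1 := by
  have hr := smoothNorm_pos hη (shiftedMatVec z x)
  rw [gordonNormal, norm_smul, norm_inv, Real.norm_of_nonneg hr.le, inv_mul_le_iff₀ hr, mul_one]
  exact norm_le_smoothNorm η _

theorem smoothNormDeriv_eq_inner_gordonNormal (η : ℝ) (z : EuclideanSpace ℝ (Fin p))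
    (x : GordonSpace n p) (u : EuclideanSpace ℝ (Fin n)) :
    smoothNormDeriv η (shiftedMatVec z x) u = inner ℝ (gordonNormal η z x) u := by
  rw [gordonNormal, inner_smul_left, smoothNormDeriv, div_eq_inv_mul]
  simp

theorem gordonDeriv_matrix (η : ℝ) (z : EuclideanSpace ℝ (Fin p)) (x : GordonSpace n p)
    (G : EuclideanSpace ℝ (Fin n × Fin p)) :
    gordonDeriv η z x (G, 0, 0) = inner ℝ (-outerVec (gordonNormal η z x) z) G := by
  rw [gordonDeriv, smoothNormDeriv_eq_inner_gordonNormal, shiftedMatVec_apply, lastInner_apply,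
    inner_neg_left, ← inner_matVec]
  simp

theorem gordonDeriv_vector (η : ℝ) (z : EuclideanSpace ℝ (Fin p)) (x : GordonSpace n p)
    (v : EuclideanSpace ℝ (Fin n) × EuclideanSpace ℝ (Fin p)) :
    gordonDeriv η z x (0, v) = inner ℝ (-gordonNormal η z x) v.1 + inner ℝ z v.2 := by
  rw [gordonDeriv, smoothNormDeriv_eq_inner_gordonNormal, shiftedMatVec_apply, lastInner_apply,
    inner_neg_left]
  simp

theorem integral_gordonDeriv_sq_matrixLaw (η : ℝ) {z : EuclideanSpace ℝ (Fin p)} (hz : ‖z‖ = 1)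
    (hc : ∀ x : GordonSpace n p, Continuous (gordonDeriv η z x)) (x : GordonSpace n p) :
    ∫ v, gordonDeriv η z x v ^ 2 ∂(matrixLaw n p) = ‖gordonNormal η z x‖ ^ 2 := by
  rw [integral_matrixLaw (F := fun v => gordonDeriv η z x v ^ 2) ((hc x).pow 2)]
  simp only [gordonDeriv_matrix]
  rw [integral_inner_sq_stdGaussian, norm_neg, norm_outerVec_sq, hz, one_pow, mul_one]

theorem integral_gordonDeriv_sq_vectorLaw (η : ℝ) {z : EuclideanSpace ℝ (Fin p)} (hz : ‖z‖ = 1)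
    (hc : ∀ x : GordonSpace n p, Continuous (gordonDeriv η z x)) (x : GordonSpace n p) :
    ∫ v, gordonDeriv η z x v ^ 2 ∂(vectorLaw n p) = ‖gordonNormal η z x‖ ^ 2 + 1 := by
  rw [integral_vectorLaw (F := fun v => gordonDeriv η z x v ^ 2) ((hc x).pow 2)]
  simp only [gordonDeriv_vector]
  rw [integral_inner_add_inner_sq, norm_neg, hz, one_pow]

/-- The second derivative has the same mean under `matrixLaw` as under `vectorLaw`
(`integral_gordonDeriv2_vectorLaw`), so that only the first derivatives enter the comparison. -/
theorem integral_gordonDeriv2_matrixLaw (η : ℝ) {z : EuclideanSpace ℝ (Fin p)} (hz : ‖z‖ = 1)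
    (hc : ∀ x : GordonSpace n p, Continuous (gordonDeriv2 η z x)) (x : GordonSpace n p) :
    ∫ v, gordonDeriv2 η z x v ∂(matrixLaw n p)
      = -((n - ‖gordonNormal η z x‖ ^ 2) / smoothNorm η (shiftedMatVec z x)) := by
  rw [integral_matrixLaw (hc x)]
  have e : ∀ G : EuclideanSpace ℝ (Fin n × Fin p), gordonDeriv2 η z x (G, 0, 0)
      = -((‖matVec z G‖ ^ 2 - (inner ℝ (outerVec (gordonNormal η z x) z) G) ^ 2)
        / smoothNorm η (shiftedMatVec z x)) := fun G => by
    rw [gordonDeriv2, smoothNormDeriv2, smoothNormDeriv_eq_inner_gordonNormal,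
      ← inner_matVec]
    simp [shiftedMatVec_apply]
  have i1 : Integrable (fun G : EuclideanSpace ℝ (Fin n × Fin p) => ‖matVec z G‖ ^ 2)
      (stdGaussian (EuclideanSpace ℝ (Fin n × Fin p))) := by
    refine (integrable_norm_sq_stdGaussian.const_mul (‖matVec (n := n) z‖ ^ 2)).mono'
      (by fun_prop) (ae_of_all _ fun G => ?_)
    rw [norm_pow, norm_norm, ← mul_pow]
    gcongr
    exact (matVec z).le_opNorm G
  simp only [e]
  rw [integral_neg, integral_div, integral_sub i1 (integrable_inner_sq_stdGaussian _),
    integral_norm_matVec_sq, integral_inner_sq_stdGaussian, norm_outerVec_sq, hz]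
  norm_num

theorem integral_gordonDeriv2_vectorLaw (η : ℝ) (z : EuclideanSpace ℝ (Fin p))
    (hc : ∀ x : GordonSpace n p, Continuous (gordonDeriv2 η z x)) (x : GordonSpace n p) :
    ∫ v, gordonDeriv2 η z x v ∂(vectorLaw n p)
      = -((n - ‖gordonNormal η z x‖ ^ 2) / smoothNorm η (shiftedMatVec z x)) := by
  rw [integral_vectorLaw (hc x)]
  have e : ∀ v : EuclideanSpace ℝ (Fin n) × EuclideanSpace ℝ (Fin p), gordonDeriv2 η z x (0, v)
      = -((‖v.1‖ ^ 2 - (inner ℝ (gordonNormal η z x) v.1) ^ 2)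
        / smoothNorm η (shiftedMatVec z x)) := fun v => by
    rw [gordonDeriv2, smoothNormDeriv2, smoothNormDeriv_eq_inner_gordonNormal]
    simp [shiftedMatVec_apply]
  simp only [e]
  rw [integral_fun_fst (fun h : EuclideanSpace ℝ (Fin n) =>
    -((‖h‖ ^ 2 - (inner ℝ (gordonNormal η z x) h) ^ 2) / smoothNorm η (shiftedMatVec z x))),
    integral_neg, integral_div, integral_sub integrable_norm_sq_stdGaussian
    (integrable_inner_sq_stdGaussian _), integral_norm_sq_stdGaussian,
    integral_inner_sq_stdGaussian]
  simp

variable {ι : Type*} [Fintype ι] [Nonempty ι]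

/-- **Gordon's inequality, exponential form.** With `G`, `h`, `g` independent and standard Gaussian
and unit vectors `zᵢ`, smoothed versions of the random variables `minᵢ ‖G zᵢ‖` and
`minᵢ (‖h‖ - ⟪zᵢ, g⟫)` satisfy
`𝔼 exp (-s minᵢ ‖G zᵢ‖) ≤ exp (s ^ 2 / 2) * exp (-s 𝔼 minᵢ (‖h‖ - ⟪zᵢ, g⟫))`.
The comparison gains a factor `exp (-s ^ 2 / 2)`, and concentration of the right-hand side, a
`√2`-Lipschitz function of `(h, g)`, costs `exp (s ^ 2)`. -/
theorem integral_exp_smoothMax_gordonFun_le {η : ℝ} (hη : 0 < η) {s k : ℝ} (hs : 0 < s)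
    (hk : s ≤ k) {z : ι → EuclideanSpace ℝ (Fin p)} (hz : ∀ i, ‖z i‖ = 1) :
    (∃ d1 d2 d3 C, SmoothAlongLines
      (fun x : GordonSpace n p => s * smoothMax k (fun i => gordonFun η (z i) x)) d1 d2 d3 C) ∧
    ∫ x, Real.exp (s * smoothMax k (fun i => gordonFun η (z i) x)) ∂(matrixLaw n p)
      ≤ Real.exp (s ^ 2 / 2 + ∫ x, s * smoothMax k (fun i => gordonFun η (z i) x)
        ∂(vectorLaw n p)) := by
  choose d3 C₀ hsm₀ using fun i => smoothAlongLines_gordonFun (n := n) hη (z i)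
  obtain ⟨C, hCmax⟩ := (Set.finite_range C₀).bddAbove
  have hsm := fun i => (hsm₀ i).mono (hCmax (Set.mem_range_self i))
  obtain ⟨C', hM⟩ := smoothAlongLines_smoothMax hsm (hs.trans_le hk)
  have hf := hM.const_mul s
  refine ⟨⟨_, _, _, _, hf⟩, ?_⟩
  set p' : GordonSpace n p → ι → ℝ := fun x => gibbsWeight k (fun j => gordonFun η (z j) x)
    with hp'
  set D1 := smoothMaxDeriv k (fun i => gordonFun (n := n) η (z i)) (fun i => gordonDeriv η (z i))
    with hD1
  set D2 := smoothMaxDeriv2 k (fun i => gordonFun (n := n) η (z i)) (fun i => gordonDeriv η (z i))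
    (fun i => gordonDeriv2 η (z i)) with hD2
  have hp0 : ∀ x i, 0 ≤ p' x i := fun x i => gibbsWeight_nonneg _ _ _
  have hp1 : ∀ x, ∑ i, p' x i = 1 := fun x => sum_gibbsWeight _ _
  -- second moments of the first derivative
  have hD1μ : ∀ x, ∫ v, D1 x v ^ 2 ∂(matrixLaw n p)
      = ‖∑ i, p' x i • outerVec (gordonNormal η (z i) x) (z i)‖ ^ 2 := fun x => by
    rw [integral_matrixLaw (F := fun v => D1 x v ^ 2) ((hM.cont1 x).pow 2)]
    have e : ∀ G : EuclideanSpace ℝ (Fin n × Fin p), D1 x (G, 0, 0)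
        = inner ℝ (-∑ i, p' x i • outerVec (gordonNormal η (z i) x) (z i)) G := fun G => by
      simp only [hD1, smoothMaxDeriv, gordonDeriv_matrix]
      rw [← Finset.sum_neg_distrib, sum_inner]
      refine Finset.sum_congr rfl fun i _ => ?_
      rw [← smul_neg, inner_smul_left]
      rfl
    simp only [e]
    rw [integral_inner_sq_stdGaussian, norm_neg]
  have hD1ν : ∀ x, ∫ v, D1 x v ^ 2 ∂(vectorLaw n p)
      = ‖∑ i, p' x i • gordonNormal η (z i) x‖ ^ 2 + ‖∑ i, p' x i • z i‖ ^ 2 := fun x => by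
    rw [integral_vectorLaw (F := fun v => D1 x v ^ 2) ((hM.cont1 x).pow 2)]
    have e : ∀ v : EuclideanSpace ℝ (Fin n) × EuclideanSpace ℝ (Fin p), D1 x (0, v)
        = inner ℝ (-∑ i, p' x i • gordonNormal η (z i) x) v.1
          + inner ℝ (∑ i, p' x i • z i) v.2 := fun v => by
      simp only [hD1, smoothMaxDeriv, gordonDeriv_vector]
      rw [← Finset.sum_neg_distrib, sum_inner, sum_inner, ← Finset.sum_add_distrib]
      refine Finset.sum_congr rfl fun i _ => ?_
      rw [← smul_neg, inner_smul_left, inner_smul_left, mul_add]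
      rfl
    simp only [e]
    rw [integral_inner_add_inner_sq, norm_neg]
  -- the integrated second-order term
  have hqρ : ∀ (ρ : Measure (GordonSpace n p)) [IsGaussian ρ], ∀ x,
      ∫ v, (s * D2 x v + (s * D1 x v) ^ 2) ∂ρ
        = s * ∑ i, p' x i * (∫ v, gordonDeriv2 η (z i) x v ∂ρ
            + k * ∫ v, gordonDeriv η (z i) x v ^ 2 ∂ρ)
          + (s ^ 2 - s * k) * ∫ v, D1 x v ^ 2 ∂ρ := by
    intro ρ _ x
    have e : ∀ v, s * D2 x v + (s * D1 x v) ^ 2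
        = s * ∑ i, p' x i * (gordonDeriv2 η (z i) x v + k * gordonDeriv η (z i) x v ^ 2)
          + (s ^ 2 - s * k) * D1 x v ^ 2 := fun v => by
      rw [hD2, smoothMaxDeriv2_eq]
      ring
    have i0 : ∀ i, Integrable (fun v => gordonDeriv2 η (z i) x v
        + k * gordonDeriv η (z i) x v ^ 2) ρ := fun i =>
      ((hsm i).integrable_d2 ρ x).add (((hsm i).integrable_d1_sq ρ x).const_mul k)
    have i1 : Integrable (fun v => ∑ i, p' x i * (gordonDeriv2 η (z i) x v
        + k * gordonDeriv η (z i) x v ^ 2)) ρ :=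
      integrable_finsetSum _ fun i _ => (i0 i).const_mul _
    simp only [e]
    rw [integral_add (i1.const_mul _) ((hM.integrable_d1_sq ρ x).const_mul _), integral_const_mul,
      integral_const_mul, integral_finsetSum _ fun i _ => (i0 i).const_mul _]
    congr 2
    refine Finset.sum_congr rfl fun i _ => ?_
    rw [integral_const_mul, integral_add ((hsm i).integrable_d2 ρ x)
      (((hsm i).integrable_d1_sq ρ x).const_mul k), integral_const_mul]
  -- the Gibbs average of the squared first derivatives is larger by `1` under `vectorLaw`; the
  -- factor `s ^ 2 - s * k ≤ 0` has the sign for which the covariance inequality is of use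
  have hcomp := hf.integral_exp_le_of_comparison (μ := matrixLaw n p) (ν := vectorLaw n p)
    integral_id_matrixLaw integral_id_vectorLaw (-s ^ 2) fun x => by
      rw [hqρ, hqρ, hD1μ, hD1ν]
      have hcov := norm_sum_sq_add_norm_sum_sq_le (hp0 x) (hp1 x)
        (fun i => norm_gordonNormal_le hη (z i) x) (fun i => (hz i).le)
      have hsum : ∑ i, p' x i * (∫ v, gordonDeriv2 η (z i) x v ∂(vectorLaw n p)
            + k * ∫ v, gordonDeriv η (z i) x v ^ 2 ∂(vectorLaw n p))
          = ∑ i, p' x i * (∫ v, gordonDeriv2 η (z i) x v ∂(matrixLaw n p)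
            + k * ∫ v, gordonDeriv η (z i) x v ^ 2 ∂(matrixLaw n p)) + k := by
        have e : k = ∑ i, p' x i * k := by rw [← Finset.sum_mul, hp1, one_mul]
        nth_rewrite 3 [e]
        rw [← Finset.sum_add_distrib]
        refine Finset.sum_congr rfl fun i _ => ?_
        rw [integral_gordonDeriv2_vectorLaw η (z i) (hsm i).cont2,
          integral_gordonDeriv2_matrixLaw η (hz i) (hsm i).cont2,
          integral_gordonDeriv_sq_vectorLaw η (hz i) (hsm i).cont1,
          integral_gordonDeriv_sq_matrixLaw η (hz i) (hsm i).cont1]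
        ring
      rw [hsum]
      have hsk : 0 ≤ s * k - s ^ 2 := by nlinarith
      nlinarith [mul_le_mul_of_nonneg_left hcov hsk]
  have hconc := hf.integral_exp_le_exp_integral (ν := vectorLaw n p) integral_id_vectorLaw
    (κ := 2 * s ^ 2) fun x => by
      simp only [mul_pow]
      rw [integral_const_mul, hD1ν]
      -- both parts of the gradient are averages of vectors of norm at most one
      have b : ∀ {E : Type} [NormedAddCommGroup E] [NormedSpace ℝ E] (u : ι → E),
          (∀ i, ‖u i‖ ≤ 1) → ‖∑ i, p' x i • u i‖ ^ 2 ≤ 1 := by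
        intro E _ _ u hu
        refine pow_le_one₀ (norm_nonneg _) ?_
        calc ‖∑ i, p' x i • u i‖ ≤ ∑ i, ‖p' x i • u i‖ := norm_sum_le _ _
          _ ≤ ∑ i, p' x i := Finset.sum_le_sum fun i _ => by
              rw [norm_smul, Real.norm_of_nonneg (hp0 x i)]
              exact mul_le_of_le_one_right (hp0 x i) (hu i)
          _ = 1 := hp1 x
      have b1 := b _ fun i => norm_gordonNormal_le hη (z i) x
      have b2 := b z fun i => (hz i).le
      nlinarith [sq_nonneg s]
  calc _ ≤ Real.exp (-s ^ 2 / 2) * ∫ x, Real.exp (s * smoothMax k (fun i => gordonFun η (z i) x))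
          ∂(vectorLaw n p) := hcomp
    _ ≤ Real.exp (-s ^ 2 / 2) * Real.exp (2 * s ^ 2 / 2
        + ∫ x, s * smoothMax k (fun i => gordonFun η (z i) x) ∂(vectorLaw n p)) := by gcongr
    _ = _ := by
        rw [← Real.exp_add]
        ring_nf

end Gordon

/-! ### The smallest gain of a Gaussian matrix on a subset of the sphere -/

section Escape

variable {n p : ℕ}

/-- The mean of the right-hand side of Gordon's comparison is at most `-(λₙ - E m)`, up to the error
of the smoothed maximum. -/
theorem integral_smoothMax_gordonFun_le {ι : Type*} [Fintype ι] [Nonempty ι] {η k : ℝ}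
    (hk : 0 < k) {z : ι → EuclideanSpace ℝ (Fin p)}
    {m : EuclideanSpace ℝ (Fin p) → ℝ}
    (hm : Integrable m (stdGaussian (EuclideanSpace ℝ (Fin p))))
    (hzm : ∀ i g, inner ℝ (z i) g ≤ m g)
    (hc : Continuous fun x : GordonSpace n p => smoothMax k (fun i => gordonFun η (z i) x))
    (hi : Integrable (fun x : GordonSpace n p => smoothMax k (fun i => gordonFun η (z i) x))
      (vectorLaw n p)) :
    ∫ x, smoothMax k (fun i => gordonFun η (z i) x) ∂(vectorLaw n p)
      ≤ -gaussianLength n + ∫ g, m g ∂(stdGaussian (EuclideanSpace ℝ (Fin p)))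
        + Real.log (Fintype.card ι) / k := by
  rw [integral_vectorLaw hc]
  have i1 : Integrable (fun v : EuclideanSpace ℝ (Fin n) × EuclideanSpace ℝ (Fin p) => -‖v.1‖)
      ((stdGaussian (EuclideanSpace ℝ (Fin n))).prod (stdGaussian (EuclideanSpace ℝ (Fin p)))) :=
    (integrable_norm_stdGaussian.comp_fst _).neg
  have i2 : Integrable (fun v : EuclideanSpace ℝ (Fin n) × EuclideanSpace ℝ (Fin p) => m v.2)
      ((stdGaussian (EuclideanSpace ℝ (Fin n))).prod (stdGaussian (EuclideanSpace ℝ (Fin p)))) :=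
    hm.comp_snd _
  have i12 : Integrable (fun v : EuclideanSpace ℝ (Fin n) × EuclideanSpace ℝ (Fin p) =>
      -‖v.1‖ + m v.2)
      ((stdGaussian (EuclideanSpace ℝ (Fin n))).prod (stdGaussian (EuclideanSpace ℝ (Fin p)))) :=
    i1.add i2
  calc _ ≤ ∫ v : EuclideanSpace ℝ (Fin n) × EuclideanSpace ℝ (Fin p),
        (-‖v.1‖ + m v.2 + Real.log (Fintype.card ι) / k)
        ∂((stdGaussian (EuclideanSpace ℝ (Fin n))).prod
          (stdGaussian (EuclideanSpace ℝ (Fin p)))) := by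
        refine integral_mono ((integrable_map_measure hc.measurable.aestronglyMeasurable
          (by fun_prop)).1 hi) (i12.add (integrable_const _)) fun v => ?_
        refine smoothMax_le hk fun i => ?_
        have h1 := norm_le_smoothNorm η v.1
        have h2 := hzm i v.2
        simp only [gordonFun, shiftedMatVec_apply, lastInner_apply, map_zero, zero_add]
        linarith
    _ = _ := by
        rw [integral_add i12 (integrable_const _), integral_add i1 i2,
          integral_fun_fst (fun h : EuclideanSpace ℝ (Fin n) => -‖h‖),
          integral_fun_snd m, integral_neg]
        simp [gaussianLength]

/-- The lower tail of `minᵢ ‖G zᵢ‖` for finitely many unit vectors `zᵢ`. The majorant `m` of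
`maxᵢ ⟪zᵢ, g⟫` allows for the supremum over an infinite set containing the `zᵢ`. -/
theorem measureReal_exists_norm_matVec_le {ι : Type*} [Fintype ι] [Nonempty ι]
    {z : ι → EuclideanSpace ℝ (Fin p)} (hz : ∀ i, ‖z i‖ = 1)
    {m : EuclideanSpace ℝ (Fin p) → ℝ}
    (hm : Integrable m (stdGaussian (EuclideanSpace ℝ (Fin p))))
    (hzm : ∀ i g, inner ℝ (z i) g ≤ m g) {c t : ℝ}
    (ht : t = gaussianLength n - ∫ g, m g ∂(stdGaussian (EuclideanSpace ℝ (Fin p))) - c)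
    (ht0 : 0 ≤ t) :
    (stdGaussian (EuclideanSpace ℝ (Fin n × Fin p))).real {G | ∃ i, ‖matVec (z i) G‖ ≤ c}
      ≤ Real.exp (-(1 / 2) * t ^ 2) := by
  rcases ht0.eq_or_lt with rfl | ht0
  · simp
  -- Chernoff's bound with exponent `t`, before the smoothing parameters are removed
  have key : ∀ η k : ℝ, 0 < η → t ≤ k →
      (stdGaussian (EuclideanSpace ℝ (Fin n × Fin p))).real {G | ∃ i, ‖matVec (z i) G‖ ≤ c}
        ≤ Real.exp (-(1 / 2) * t ^ 2 + t * η + t * Real.log (Fintype.card ι) * (1 / k)) := by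
    intro η k hη hk
    have hk0 : 0 < k := ht0.trans_le hk
    obtain ⟨⟨d1, d2, d3, C, hsm⟩, hle⟩ :=
      integral_exp_smoothMax_gordonFun_le (n := n) hη ht0 hk hz
    have hc : Continuous fun x : GordonSpace n p => smoothMax k (fun i => gordonFun η (z i) x) := by
      have := hsm.continuous.const_mul t⁻¹
      simpa [← mul_assoc, inv_mul_cancel₀ ht0.ne'] using this
    have hi : Integrable (fun x : GordonSpace n p => smoothMax k (fun i => gordonFun η (z i) x))
        (vectorLaw n p) := by
      have := (hsm.integrable (vectorLaw n p)).const_mul t⁻¹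
      simpa [← mul_assoc, inv_mul_cancel₀ ht0.ne'] using this
    have hmean := integral_smoothMax_gordonFun_le hk0 hm hzm hc hi
    rw [integral_const_mul] at hle
    have hcexp : Continuous fun x : GordonSpace n p =>
        Real.exp (t * smoothMax k (fun i => gordonFun η (z i) x)) := by fun_prop
    have hiG : Integrable (fun G => Real.exp (t * smoothMax k
        (fun i => gordonFun η (z i) ((G, 0, 0) : GordonSpace n p))))
        (stdGaussian (EuclideanSpace ℝ (Fin n × Fin p))) :=
      (integrable_map_measure hcexp.measurable.aestronglyMeasurable (by fun_prop)).1
        (hsm.integrable_exp (matrixLaw n p))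
    rw [integral_matrixLaw hcexp] at hle
    have hsub : {G : EuclideanSpace ℝ (Fin n × Fin p) | ∃ i, ‖matVec (z i) G‖ ≤ c}
        ⊆ {G | Real.exp (-t * (c + η)) ≤ Real.exp (t * smoothMax k
          (fun i => gordonFun η (z i) ((G, 0, 0) : GordonSpace n p)))} := by
      rintro G ⟨i, hi⟩
      refine Real.exp_le_exp.2 ?_
      have h1 := le_smoothMax hk0
        (fun i => gordonFun η (z i) ((G, 0, 0) : GordonSpace n p)) i
      have h2 := smoothNorm_le hη.le (matVec (z i) G)
      have h3 : gordonFun η (z i) ((G, 0, 0) : GordonSpace n p)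
          = -smoothNorm η (matVec (z i) G) := by
        simp [gordonFun, shiftedMatVec_apply, lastInner_apply]
      nlinarith
    have hmark := mul_meas_ge_le_integral_of_nonneg
      (ae_of_all _ fun G => (Real.exp_pos _).le) hiG (Real.exp (-t * (c + η)))
    have h4 : (stdGaussian (EuclideanSpace ℝ (Fin n × Fin p))).real
        {G | ∃ i, ‖matVec (z i) G‖ ≤ c} ≤ (stdGaussian (EuclideanSpace ℝ (Fin n × Fin p))).real
        {G | Real.exp (-t * (c + η)) ≤ Real.exp (t * smoothMax k
          (fun i => gordonFun η (z i) ((G, 0, 0) : GordonSpace n p)))} := measureReal_mono hsub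
    have h5 : Real.exp (-t * (c + η)) * (stdGaussian (EuclideanSpace ℝ (Fin n × Fin p))).real
        {G | ∃ i, ‖matVec (z i) G‖ ≤ c}
        ≤ Real.exp (-t * (c + η)) * Real.exp (-(1 / 2) * t ^ 2 + t * η
          + t * Real.log (Fintype.card ι) * (1 / k)) := by
      refine (mul_le_mul_of_nonneg_left h4 (Real.exp_pos _).le).trans (hmark.trans (hle.trans ?_))
      rw [← Real.exp_add]
      refine Real.exp_le_exp.2 ?_
      have h6 := mul_le_mul_of_nonneg_left hmean ht0.le
      have h7 : t * (-gaussianLength n + ∫ g, m g ∂(stdGaussian (EuclideanSpace ℝ (Fin p)))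
          + Real.log (Fintype.card ι) / k)
          = -t ^ 2 - t * c + t * Real.log (Fintype.card ι) * (1 / k) := by
        rw [ht]; ring
      rw [h7] at h6
      linarith
    exact le_of_mul_le_mul_left h5 (Real.exp_pos _)
  have hlim : Filter.Tendsto (fun j : ℕ => Real.exp (-(1 / 2) * t ^ 2
      + t * (1 / ((j : ℝ) + 1)) + t * Real.log (Fintype.card ι) * (1 / (t + j)))) Filter.atTop
      (nhds (Real.exp (-(1 / 2) * t ^ 2 + t * 0 + t * Real.log (Fintype.card ι) * 0))) := by
    refine (Real.continuous_exp.tendsto _).comp ((tendsto_const_nhds.add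
      (tendsto_one_div_add_atTop_nhds_zero_nat.const_mul t)).add (Filter.Tendsto.const_mul _ ?_))
    have := (Filter.tendsto_atTop_add_const_left Filter.atTop t
      tendsto_natCast_atTop_atTop).inv_tendsto_atTop (𝕜 := ℝ)
    simp only [one_div]
    exact this
  rw [mul_zero, mul_zero, add_zero, add_zero] at hlim
  exact ge_of_tendsto' hlim fun j => key _ _ (by positivity) (by simp)

/-- **Gordon's escape theorem.** A Gaussian matrix `G` satisfies `c ≤ ‖G z‖` for all `z` in a set
`S` of unit vectors, with probability at least `1 - exp (-(λₙ - w(S) - c) ^ 2 / 2)`. -/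
theorem exists_forall_le_norm_matVec {S : Set (EuclideanSpace ℝ (Fin p))} (hS : S.Nonempty)
    (hS1 : S ⊆ Metric.sphere 0 1) {c : ℝ} (hc : 0 ≤ gaussianLength n - gaussianWidth S - c) :
    ∃ E : Set (EuclideanSpace ℝ (Fin n × Fin p)), MeasurableSet E ∧
      (∀ G ∈ E, ∀ z ∈ S, c ≤ ‖matVec z G‖) ∧
      1 - Real.exp (-(1 / 2) * (gaussianLength n - gaussianWidth S - c) ^ 2)
        ≤ (stdGaussian (EuclideanSpace ℝ (Fin n × Fin p))).real E := by
  have : Nonempty S := hS.to_subtype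
  have hunit : ∀ z : S, ‖(z : EuclideanSpace ℝ (Fin p))‖ = 1 := fun z =>
    mem_sphere_zero_iff_norm.1 (hS1 z.2)
  set m : EuclideanSpace ℝ (Fin p) → ℝ :=
    fun g => ⨆ z : S, inner ℝ g (z : EuclideanSpace ℝ (Fin p)) with hm
  have hle : ∀ g (z : S), inner ℝ g (z : EuclideanSpace ℝ (Fin p)) ≤ ‖g‖ := fun g z => by
    have := real_inner_le_norm g (z : EuclideanSpace ℝ (Fin p))
    rwa [hunit, mul_one] at this
  have hbdd : ∀ g, BddAbove (Set.range fun z : S => inner ℝ g (z : EuclideanSpace ℝ (Fin p))) :=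
    fun g => ⟨‖g‖, by rintro _ ⟨z, rfl⟩; exact hle g z⟩
  have hmle : ∀ g g', m g ≤ m g' + ‖g - g'‖ := fun g g' => by
    refine ciSup_le fun z => ?_
    have h1 := le_ciSup (hbdd g') z
    have h2 := hle (g - g') z
    rw [inner_sub_left] at h2
    linarith
  have hcont : Continuous m := by
    have : LipschitzWith 1 m := LipschitzWith.of_le_add fun g g' => by
      rw [dist_eq_norm]; exact hmle g g'
    exact this.continuous
  have hint : Integrable m (stdGaussian (EuclideanSpace ℝ (Fin p))) := by
    refine integrable_norm_stdGaussian.mono' hcont.measurable.aestronglyMeasurable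
      (ae_of_all _ fun g => ?_)
    have h0 : m 0 = 0 := by simp [hm]
    have h1 := hmle g 0
    have h2 := hmle 0 g
    rw [h0, sub_zero] at h1
    rw [h0, zero_sub, norm_neg] at h2
    exact abs_le.2 ⟨by linarith, by linarith⟩
  -- a countable dense subset suffices, and is exhausted by finite ones
  set z : ℕ → S := TopologicalSpace.denseSeq S with hz
  have hzm : ∀ i g, inner ℝ (z i : EuclideanSpace ℝ (Fin p)) g ≤ m g := fun i g => by
    rw [real_inner_comm]
    exact le_ciSup (hbdd g) (z i)
  set B : Set (EuclideanSpace ℝ (Fin n × Fin p)) :=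
    {G | ∃ i, ‖matVec (z i : EuclideanSpace ℝ (Fin p)) G‖ ≤ c} with hB
  have hBm : MeasurableSet B := by
    rw [hB, Set.ofPred_exists]
    exact MeasurableSet.iUnion fun i => measurableSet_le (by fun_prop) measurable_const
  have hBle : (stdGaussian (EuclideanSpace ℝ (Fin n × Fin p))).real B
      ≤ Real.exp (-(1 / 2) * (gaussianLength n - gaussianWidth S - c) ^ 2) := by
    have hBU : B = ⋃ N : ℕ, {G | ∃ i : Fin (N + 1),
        ‖matVec (z i : EuclideanSpace ℝ (Fin p)) G‖ ≤ c} := by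
      ext G
      simp only [hB, Set.mem_ofPred_eq, Set.mem_iUnion]
      exact ⟨fun ⟨i, hi⟩ => ⟨i, ⟨i, Nat.lt_succ_self i⟩, hi⟩, fun ⟨_, i, hi⟩ => ⟨i, hi⟩⟩
    have hmono : Monotone fun N : ℕ => {G : EuclideanSpace ℝ (Fin n × Fin p) | ∃ i : Fin (N + 1),
        ‖matVec (z i : EuclideanSpace ℝ (Fin p)) G‖ ≤ c} := by
      rintro N M hNM G ⟨i, hi⟩
      exact ⟨⟨i, by omega⟩, hi⟩
    refine ENNReal.toReal_le_of_le_ofReal (Real.exp_pos _).le ?_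
    rw [hBU, hmono.measure_iUnion]
    refine iSup_le fun N => ?_
    rw [← ofReal_measureReal]
    refine ENNReal.ofReal_le_ofReal ?_
    exact measureReal_exists_norm_matVec_le (fun i => hunit _) hint (fun i g => hzm _ g) rfl hc
  refine ⟨Bᶜ, hBm.compl, fun G hG y hy => ?_, ?_⟩
  · have hG' : ∀ i, c ≤ ‖matVec (z i : EuclideanSpace ℝ (Fin p)) G‖ := fun i => by
      by_contra! h
      exact hG ⟨i, h.le⟩
    exact (TopologicalSpace.denseRange_denseSeq S).induction_on
      (p := fun y : S => c ≤ ‖matVec (y : EuclideanSpace ℝ (Fin p)) G‖) ⟨y, hy⟩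
      (isClosed_le continuous_const
        (continuous_norm.comp ((continuous_matVec G).comp continuous_subtype_val))) hG'
  · rw [probReal_compl_eq_one_sub hBm]
    linarith

end Escape

section Length

theorem one_add_sq_half_le_exp_add_exp_neg (y : ℝ) :
    1 + y ^ 2 / 2 ≤ (Real.exp y + Real.exp (-y)) / 2 := by
  have h1 : |y| ≤ |Real.exp (y / 2) - Real.exp (-(y / 2))| := by
    have h2 : ∀ u : ℝ, 0 ≤ u → u ≤ Real.exp (u / 2) - Real.exp (-(u / 2)) := fun u hu => by
      have := Real.self_le_sinh_iff.2 (show 0 ≤ u / 2 by positivity)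
      rw [Real.sinh_eq] at this
      linarith
    rcases le_total 0 y with hy | hy
    · rw [abs_of_nonneg hy]
      exact (h2 y hy).trans (le_abs_self _)
    · rw [abs_of_nonpos hy, abs_sub_comm]
      have := h2 (-y) (by linarith)
      rw [neg_div, neg_neg] at this
      exact this.trans (le_abs_self _)
  have h3 := sq_le_sq.2 h1
  have h4 : Real.exp (y / 2) ^ 2 = Real.exp y := by rw [← Real.exp_nat_mul]; ring_nf
  have h5 : Real.exp (-(y / 2)) ^ 2 = Real.exp (-y) := by rw [← Real.exp_nat_mul]; ring_nf
  have h6 : Real.exp (y / 2) * Real.exp (-(y / 2)) = 1 := by rw [← Real.exp_add]; simp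
  nlinarith

/-- A centred random variable with sub-Gaussian moment generating function of parameter `1` has
variance at most `1`. -/
theorem integral_sq_le_one_of_mgf_le {Ω : Type*} [MeasurableSpace Ω] {P : Measure Ω}
    [IsProbabilityMeasure P] {X : Ω → ℝ} (hX2 : Integrable (fun ω => X ω ^ 2) P)
    (hint : ∀ s : ℝ, Integrable (fun ω => Real.exp (s * X ω)) P)
    (hmgf : ∀ s : ℝ, ∫ ω, Real.exp (s * X ω) ∂P ≤ Real.exp (s ^ 2 / 2)) :
    ∫ ω, X ω ^ 2 ∂P ≤ 1 := by
  -- average the bounds for `s` and `-s`, compare the terms of order `s ^ 2`, and let `s → 0`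
  have hs : ∀ s : ℝ, 0 < s → s ≤ 1 → ∫ ω, X ω ^ 2 ∂P ≤ 1 + s ^ 2 := by
    intro s hs hs1
    have h1 : ∫ ω, (1 + s ^ 2 / 2 * X ω ^ 2) ∂P
        ≤ ∫ ω, (1 / 2 * (Real.exp (s * X ω) + Real.exp (-s * X ω))) ∂P := by
      refine integral_mono ((integrable_const _).add (hX2.const_mul _))
        (((hint s).add (hint (-s))).const_mul _) fun ω => ?_
      have := one_add_sq_half_le_exp_add_exp_neg (s * X ω)
      simp only [neg_mul]
      nlinarith
    rw [integral_add (integrable_const _) (hX2.const_mul _), integral_const_mul,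
      integral_const_mul, integral_add (hint s) (hint (-s))] at h1
    have h2 := hmgf s
    have h3 := hmgf (-s)
    rw [neg_sq] at h3
    have h4 : Real.exp (s ^ 2 / 2) ≤ 1 + s ^ 2 / 2 + (s ^ 2 / 2) ^ 2 := by
      have := Real.abs_exp_sub_one_sub_id_le (x := s ^ 2 / 2)
        (by rw [abs_of_nonneg (by positivity)]; nlinarith)
      linarith [(abs_le.1 this).2]
    simp only [integral_const, probReal_univ, smul_eq_mul, mul_one] at h1
    have h5 : s ^ 2 * ∫ ω, X ω ^ 2 ∂P ≤ s ^ 2 * (1 + s ^ 2) := by nlinarith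
    exact le_of_mul_le_mul_left h5 (by positivity)
  refine le_of_forall_pos_le_add fun ε hε => ?_
  have hm0 : 0 < min 1 ε := lt_min one_pos hε
  have := hs (min 1 ε) hm0 (min_le_left _ _)
  have h6 : (min 1 ε) ^ 2 ≤ ε := by
    have h7 := min_le_left 1 ε
    have h8 := min_le_right 1 ε
    nlinarith
  linarith

/-- `λₙ² ≥ n - 1`: the length of a standard Gaussian vector has variance at most `1`. -/
theorem sub_one_le_gaussianLength_sq (n : ℕ) : (n : ℝ) - 1 ≤ gaussianLength n ^ 2 := by
  set γ := stdGaussian (EuclideanSpace ℝ (Fin n)) with hγ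
  have hlen0 : 0 ≤ gaussianLength n := integral_nonneg fun g => norm_nonneg g
  have key : ∀ η : ℝ, 0 < η → (n : ℝ) - 1 ≤ (gaussianLength n + η) ^ 2 := by
    intro η hη
    have hsm := smoothAlongLines_smoothNorm (H := EuclideanSpace ℝ (Fin n)) hη
    have hri : Integrable (smoothNorm η) γ := hsm.integrable γ
    set a := ∫ x, smoothNorm η x ∂γ with ha
    have hr2 : Integrable (fun x => smoothNorm η x ^ 2) γ := by
      simp only [smoothNorm_sq]
      exact integrable_norm_sq_stdGaussian.add (integrable_const _)
    have hX2e : ∀ x : EuclideanSpace ℝ (Fin n), (smoothNorm η x - a) ^ 2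
        = smoothNorm η x ^ 2 - 2 * a * smoothNorm η x + a ^ 2 := fun x => by ring
    have i1 : Integrable (fun x => smoothNorm η x ^ 2 - 2 * a * smoothNorm η x) γ :=
      hr2.sub (hri.const_mul _)
    have hX2 : Integrable (fun x => (smoothNorm η x - a) ^ 2) γ := by
      simp only [hX2e]
      exact i1.add (integrable_const _)
    have hexp : ∀ (s : ℝ) (x : EuclideanSpace ℝ (Fin n)), Real.exp (s * (smoothNorm η x - a))
        = Real.exp (-(s * a)) * Real.exp (s * smoothNorm η x) := fun s x => by
      rw [← Real.exp_add]; ring_nf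
    have hvar := integral_sq_le_one_of_mgf_le hX2
      (fun s => by
        simp only [hexp]
        exact ((hsm.const_mul s).integrable_exp γ).const_mul _)
      (fun s => by
        simp only [hexp]
        rw [integral_const_mul]
        -- the smoothed norm is `1`-Lipschitz, so `κ = s ^ 2`
        have hc := (hsm.const_mul s).integral_exp_le_exp_integral (ν := γ)
          integral_id_stdGaussian_eq_zero (κ := s ^ 2) fun x => by
            have e : ∀ v, (s * smoothNormDeriv η x v) ^ 2
                = (inner ℝ ((s * (smoothNorm η x)⁻¹) • x) v) ^ 2 := fun v => by
              rw [inner_smul_left, smoothNormDeriv, div_eq_inv_mul]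
              simp [mul_assoc]
            simp only [e]
            rw [integral_inner_sq_stdGaussian, norm_smul, norm_mul, mul_assoc, mul_pow,
              Real.norm_eq_abs, sq_abs]
            refine mul_le_of_le_one_right (sq_nonneg s) (pow_le_one₀ (by positivity) ?_)
            have hr := smoothNorm_pos hη x
            rw [norm_inv, Real.norm_of_nonneg hr.le, inv_mul_le_iff₀ hr, mul_one]
            exact norm_le_smoothNorm η x
        rw [integral_const_mul, ← ha] at hc
        calc Real.exp (-(s * a)) * ∫ x, Real.exp (s * smoothNorm η x) ∂γ
            ≤ Real.exp (-(s * a)) * Real.exp (s ^ 2 / 2 + s * a) := by gcongr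
          _ = _ := by rw [← Real.exp_add]; ring_nf)
    have hval : ∫ x, (smoothNorm η x - a) ^ 2 ∂γ = n + η ^ 2 - a ^ 2 := by
      simp only [hX2e]
      rw [integral_add i1 (integrable_const _), integral_sub hr2 (hri.const_mul _),
        integral_const_mul, ← ha]
      simp only [smoothNorm_sq]
      rw [integral_add integrable_norm_sq_stdGaussian (integrable_const _),
        integral_norm_sq_stdGaussian]
      simp
      ring
    have ha0 : 0 ≤ a := integral_nonneg fun x => (smoothNorm_pos hη x).le
    have hale : a ≤ gaussianLength n + η := by
      have : a ≤ ∫ x, (‖x‖ + η) ∂γ := integral_mono hri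
        (integrable_norm_stdGaussian.add (integrable_const _)) fun x => smoothNorm_le hη.le x
      rw [integral_add integrable_norm_stdGaussian (integrable_const _)] at this
      simpa [gaussianLength] using this
    rw [hval] at hvar
    have := pow_le_pow_left₀ ha0 hale 2
    nlinarith [sq_nonneg η]
  have hlim : Filter.Tendsto (fun j : ℕ => (gaussianLength n + 1 / ((j : ℝ) + 1)) ^ 2)
      Filter.atTop (nhds ((gaussianLength n + 0) ^ 2)) :=
    (tendsto_const_nhds.add tendsto_one_div_add_atTop_nhds_zero_nat).pow 2
  rw [add_zero] at hlim
  exact ge_of_tendsto' hlim fun j => key _ (by positivity)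

end Length

/-! ### The atomic norm and its tangent cones -/

section AtomicNorm

variable {p : ℕ} {A : Set (EuclideanSpace ℝ (Fin p))}

/-- The convex hull of a compact set is compact: by Carathéodory's theorem it is a finite union of
continuous images of products of a simplex with copies of the set. -/
theorem IsCompact.isCompact_convexHull (hA : IsCompact A) : IsCompact (convexHull ℝ A) := by
  let comb (k : ℕ) (q : (Fin k → ℝ) × (Fin k → EuclideanSpace ℝ (Fin p))) :
      EuclideanSpace ℝ (Fin p) := ∑ i, q.1 i • q.2 i
  have hunion : convexHull ℝ A = ⋃ k ∈ Finset.range (p + 2),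
      comb k '' (stdSimplex ℝ (Fin k) ×ˢ Set.univ.pi fun _ => A) := by
    refine Set.Subset.antisymm (fun x hx => ?_) (Set.iUnion₂_subset fun k _ => ?_)
    · obtain ⟨ι, _, z, w, hz, hind, hw, hw1, rfl⟩ := eq_pos_convex_span_of_mem_convexHull hx
      have hcard : Fintype.card ι ≤ p + 1 := by
        refine hind.card_le_finrank_succ.trans (Nat.succ_le_succ ?_)
        exact (Submodule.finrank_le _).trans_eq finrank_euclideanSpace_fin
      let e := Fintype.equivFin ι
      refine Set.mem_biUnion (x := Fintype.card ι)
        (Finset.mem_coe.2 (Finset.mem_range.2 (by omega)))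
        ⟨(w ∘ e.symm, z ∘ e.symm), ⟨⟨fun i => (hw _).le, ?_⟩, fun i _ => hz ⟨_, rfl⟩⟩, ?_⟩
      · exact (e.symm.sum_comp w).trans hw1
      · exact e.symm.sum_comp fun i => w i • z i
    · rintro _ ⟨q, ⟨⟨hq0, hq1⟩, hqA⟩, rfl⟩
      exact (convex_convexHull ℝ A).sum_mem (fun i _ => hq0 i) hq1
        fun i _ => subset_convexHull ℝ A (hqA i trivial)
  rw [hunion]
  refine (Finset.range (p + 2)).isCompact_biUnion fun k _ => ?_
  exact ((isCompact_stdSimplex ℝ (Fin k)).prod (isCompact_univ_pi fun _ => hA)).image (by fun_prop)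

/-- The dilates of a convex hull containing `0` are nested. -/
theorem smul_convexHull_mono (hA0 : (0 : EuclideanSpace ℝ (Fin p)) ∈ convexHull ℝ A) {s t : ℝ}
    (hs : 0 < s) (hst : s ≤ t) : s • convexHull ℝ A ⊆ t • convexHull ℝ A := by
  rintro _ ⟨y, hy, rfl⟩
  have ht : 0 < t := hs.trans_le hst
  refine ⟨(s / t) • y, (convex_convexHull ℝ A).smul_mem_of_zero_mem hA0 hy
    ⟨by positivity, (div_le_one ht).2 hst⟩, ?_⟩
  simp only [smul_smul]
  rw [mul_div_cancel₀ _ ht.ne']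

theorem atomicNorm_le_of_mem {x : EuclideanSpace ℝ (Fin p)} {t : ℝ} (ht : 0 < t)
    (hx : x ∈ t • convexHull ℝ A) : atomicNorm A x ≤ ENNReal.ofReal t :=
  iInf₂_le t ⟨ht, hx⟩

/-- The sublevel sets of the atomic norm are the dilates of `conv A`: as `conv A` is closed, the
infimum is attained at positive levels. -/
theorem atomicNorm_le_ofReal_iff (hA : IsCompact A)
    (hA0 : (0 : EuclideanSpace ℝ (Fin p)) ∈ convexHull ℝ A) {x : EuclideanSpace ℝ (Fin p)} {t : ℝ}
    (ht : 0 < t) : atomicNorm A x ≤ ENNReal.ofReal t ↔ x ∈ t • convexHull ℝ A := by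
  refine ⟨fun h => ?_, atomicNorm_le_of_mem ht⟩
  have hK : IsClosed (convexHull ℝ A) := hA.isCompact_convexHull.isClosed
  have hmem : ∀ s, t < s → s⁻¹ • x ∈ convexHull ℝ A := by
    intro s hts
    have h1 : atomicNorm A x < ENNReal.ofReal s :=
      h.trans_lt ((ENNReal.ofReal_lt_ofReal_iff (ht.trans hts)).2 hts)
    simp only [atomicNorm, iInf_lt_iff] at h1
    obtain ⟨u, ⟨hu, hxu⟩, hus⟩ := h1
    have hus' := (ENNReal.ofReal_lt_ofReal_iff (ht.trans hts)).1 hus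
    exact (Set.mem_smul_set_iff_inv_smul_mem₀ (ht.trans hts).ne' _ _).1
      (smul_convexHull_mono hA0 hu hus'.le hxu)
  rw [Set.mem_smul_set_iff_inv_smul_mem₀ ht.ne']
  have hlim : Filter.Tendsto (fun s : ℝ => s⁻¹ • x) (nhdsWithin t (Set.Ioi t)) (nhds (t⁻¹ • x)) :=
    ((Filter.tendsto_id.inv₀ ht.ne').smul_const x).mono_left nhdsWithin_le_nhds
  exact hK.mem_of_tendsto hlim (eventually_mem_nhdsWithin.mono fun s hs => hmem s hs)

theorem lowerSemicontinuous_atomicNorm (hA : IsCompact A)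
    (hA0 : (0 : EuclideanSpace ℝ (Fin p)) ∈ convexHull ℝ A) :
    LowerSemicontinuous (atomicNorm A) := by
  rw [lowerSemicontinuous_iff_isClosed_preimage]
  intro y
  have h : atomicNorm A ⁻¹' Set.Iic y
      = ⋂ (t : ℝ) (_ : 0 < t ∧ y < ENNReal.ofReal t), t • convexHull ℝ A := by
    ext x
    simp only [Set.mem_preimage, Set.mem_Iic, Set.mem_iInter]
    refine ⟨fun hx t ht => (atomicNorm_le_ofReal_iff hA hA0 ht.1).1 (hx.trans ht.2.le),
      fun hx => ?_⟩
    refine le_of_forall_gt_imp_ge_of_dense fun z hz => ?_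
    rcases eq_or_ne z ⊤ with rfl | hz'
    · exact le_top
    · have hz0 : 0 < z.toReal := ENNReal.toReal_pos (bot_le.trans_lt hz).ne' hz'
      have := atomicNorm_le_of_mem hz0 (hx z.toReal ⟨hz0, by rwa [ENNReal.ofReal_toReal hz']⟩)
      rwa [ENNReal.ofReal_toReal hz'] at this
  rw [h]
  exact isClosed_iInter fun t => isClosed_iInter fun _ => (hA.isCompact_convexHull.smul t).isClosed

theorem atomicNorm_zero (hA0 : (0 : EuclideanSpace ℝ (Fin p)) ∈ convexHull ℝ A) :
    atomicNorm A 0 = 0 := by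
  refine le_antisymm (le_of_forall_gt_imp_ge_of_dense fun z hz => ?_) bot_le
  rcases eq_or_ne z ⊤ with rfl | hz'
  · exact le_top
  · have hz0 : 0 < z.toReal := ENNReal.toReal_pos hz.ne' hz'
    have := atomicNorm_le_of_mem (A := A) hz0 ⟨0, hA0, smul_zero _⟩
    rwa [ENNReal.ofReal_toReal hz'] at this

theorem IsAtomicCombination.exists_mem_smul {x : EuclideanSpace ℝ (Fin p)}
    (hx : IsAtomicCombination A x) (hx0 : x ≠ 0) : ∃ t : ℝ, 0 < t ∧ x ∈ t • convexHull ℝ A := by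
  obtain ⟨k, c, a, hc, ha, rfl⟩ := hx
  have hpos : 0 < ∑ i, c i := by
    refine (Finset.sum_nonneg fun i _ => hc i).lt_of_ne fun h => hx0 ?_
    have h0 := (Finset.sum_eq_zero_iff_of_nonneg fun i _ => hc i).1 h.symm
    exact Finset.sum_eq_zero fun i hi => by rw [h0 i hi, zero_smul]
  refine ⟨∑ i, c i, hpos, Finset.univ.centerMass c a,
    Finset.univ.centerMass_mem_convexHull (fun i _ => hc i) hpos fun i _ => ha i, ?_⟩
  simp only [Finset.centerMass]
  rw [smul_inv_smul₀ hpos.ne']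

/-- A closed set containing a point of finite atomic norm contains a point of least atomic norm. -/
theorem exists_isAtomicMinimizer (hA : IsCompact A)
    (hA0 : (0 : EuclideanSpace ℝ (Fin p)) ∈ convexHull ℝ A) {F : Set (EuclideanSpace ℝ (Fin p))}
    (hF : IsClosed F) {x : EuclideanSpace ℝ (Fin p)} (hxF : x ∈ F) {t : ℝ} (ht : 0 < t)
    (hxt : x ∈ t • convexHull ℝ A) : ∃ y, IsAtomicMinimizer A F y := by
  have hcomp : IsCompact (t • convexHull ℝ A ∩ F) := (hA.isCompact_convexHull.smul t).inter_right hF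
  obtain ⟨y, hy, hmin⟩ := LowerSemicontinuousOn.exists_isMinOn
    (s := t • convexHull ℝ A ∩ F) ⟨x, hxt, hxF⟩ hcomp
    ((lowerSemicontinuous_atomicNorm hA hA0).lowerSemicontinuousOn _)
  refine ⟨y, hy.2, fun x' hx' => ?_⟩
  by_cases h : x' ∈ t • convexHull ℝ A
  · exact hmin ⟨h, hx'⟩
  · exact (atomicNorm_le_of_mem ht hy.1).trans
      (not_le.1 fun hle => h ((atomicNorm_le_ofReal_iff hA hA0 ht).1 hle)).le

theorem inv_norm_smul_mem_sphericalPart {x z : EuclideanSpace ℝ (Fin p)}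
    (hz : atomicNorm A z ≤ atomicNorm A x) (hzx : z ≠ x) :
    ‖z - x‖⁻¹ • (z - x) ∈ sphericalPart A x := by
  have hpos : 0 < ‖z - x‖ := norm_pos_iff.2 (sub_ne_zero.2 hzx)
  refine ⟨(ConvexCone.hull ℝ _).smul_mem (inv_pos.2 hpos)
    (ConvexCone.subset_hull ⟨z, hz, rfl⟩), ?_⟩
  rw [mem_sphere_zero_iff_norm, norm_smul, norm_inv, norm_norm, inv_mul_cancel₀ hpos.ne']

theorem sphericalPart_nonempty (hA0 : (0 : EuclideanSpace ℝ (Fin p)) ∈ convexHull ℝ A)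
    {x : EuclideanSpace ℝ (Fin p)} (hx0 : x ≠ 0) : (sphericalPart A x).Nonempty :=
  ⟨_, inv_norm_smul_mem_sphericalPart (z := 0) (by rw [atomicNorm_zero hA0]; exact bot_le)
    hx0.symm⟩

/-- A linear map with gain at least `c` on the spherical part of the tangent cone at `x` has gain
at least `c` on all differences `z - x` with `‖z‖_A ≤ ‖x‖_A`. -/
theorem mul_norm_sub_le {n : ℕ} {M : Matrix (Fin n) (Fin p) ℝ} {x : EuclideanSpace ℝ (Fin p)}
    {c : ℝ} (hM : ∀ z ∈ sphericalPart A x, c ≤ ‖Matrix.toEuclideanLin M z‖)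
    {z : EuclideanSpace ℝ (Fin p)} (hz : atomicNorm A z ≤ atomicNorm A x) :
    c * ‖z - x‖ ≤ ‖Matrix.toEuclideanLin M z - Matrix.toEuclideanLin M x‖ := by
  rcases eq_or_ne z x with rfl | hzx
  · simp
  have hpos : 0 < ‖z - x‖ := norm_pos_iff.2 (sub_ne_zero.2 hzx)
  have h := hM _ (inv_norm_smul_mem_sphericalPart hz hzx)
  rw [map_smul, norm_smul, norm_inv, norm_norm, inv_mul_eq_div, le_div_iff₀ hpos, map_sub] at h
  exact h

theorem solvesExact_iff {n : ℕ} {M : Matrix (Fin n) (Fin p) ℝ} {x : EuclideanSpace ℝ (Fin p)}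
    {c : ℝ} (hc : 0 < c) (hM : ∀ z ∈ sphericalPart A x, c ≤ ‖Matrix.toEuclideanLin M z‖)
    (y : EuclideanSpace ℝ (Fin p)) :
    SolvesExact A M (Matrix.toEuclideanLin M x) y ↔ y = x := by
  have hinj : ∀ z, Matrix.toEuclideanLin M x = Matrix.toEuclideanLin M z →
      atomicNorm A z ≤ atomicNorm A x → z = x := by
    intro z hz hle
    have h := mul_norm_sub_le hM hle
    rw [hz, sub_self, norm_zero] at h
    exact sub_eq_zero.1 (norm_le_zero_iff.1 (nonpos_of_mul_nonpos_right h hc))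
  refine ⟨fun h => hinj y h.1 (h.2 x rfl), ?_⟩
  rintro rfl
  refine ⟨rfl, fun z hz => ?_⟩
  by_contra! hlt
  rw [hinj z hz hlt.le] at hlt
  exact lt_irrefl _ hlt

theorem norm_sub_le_of_solvesNoisy {n : ℕ} {M : Matrix (Fin n) (Fin p) ℝ}
    {x y : EuclideanSpace ℝ (Fin p)} {e : EuclideanSpace ℝ (Fin n)} {ε δ : ℝ} (hε : 0 < ε)
    (hM : ∀ z ∈ sphericalPart A x, ε ≤ ‖Matrix.toEuclideanLin M z‖) (he : ‖e‖ ≤ δ)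
    (hy : SolvesNoisy A M (Matrix.toEuclideanLin M x + e) δ y) : ‖x - y‖ ≤ 2 * δ / ε := by
  have hxF : ‖Matrix.toEuclideanLin M x + e - Matrix.toEuclideanLin M x‖ ≤ δ := by
    rwa [add_sub_cancel_left]
  have h1 := mul_norm_sub_le hM (hy.2 x hxF)
  have h2 : ‖Matrix.toEuclideanLin M x + e - Matrix.toEuclideanLin M y‖ ≤ δ := hy.1
  have h3 : ‖Matrix.toEuclideanLin M y - Matrix.toEuclideanLin M x‖ ≤ δ + δ := by
    have : Matrix.toEuclideanLin M y - Matrix.toEuclideanLin M x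
        = e - (Matrix.toEuclideanLin M x + e - Matrix.toEuclideanLin M y) := by abel
    rw [this]
    exact (norm_sub_le _ _).trans (add_le_add he h2)
  rw [norm_sub_rev, le_div_iff₀ hε]
  linarith

end AtomicNorm

/-! ### Random Gaussian maps -/

section GaussianMap

variable {n p : ℕ} {Ω : Type*} [MeasurableSpace Ω] {P : Measure Ω}
  [IsProbabilityMeasure P]   {Φ : Ω → Matrix (Fin n) (Fin p) ℝ}

/-- The matrix `√n M`, regarded as a vector of `ℝ ^ (n * p)`. -/
noncomputable def scaledVec (M : Matrix (Fin n) (Fin p) ℝ) :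
    EuclideanSpace ℝ (Fin n × Fin p) :=
  WithLp.toLp 2 fun ij => √n * M ij.1 ij.2

theorem matVec_scaledVec (M : Matrix (Fin n) (Fin p) ℝ) (z : EuclideanSpace ℝ (Fin p)) :
    matVec z (scaledVec M) = √n • Matrix.toEuclideanLin M z := by
  ext i
  simp only [matVec_apply, scaledVec, PiLp.smul_apply, Matrix.toLpLin_apply, smul_eq_mul,
    Matrix.mulVec, dotProduct, Finset.mul_sum]
  exact Finset.sum_congr rfl fun j _ => by ring

theorem IsGaussianMap.hasLaw_scaledVec (hΦ : IsGaussianMap P Φ) (hn : 0 < n) :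
    HasLaw (fun ω => scaledVec (Φ ω)) (stdGaussian (EuclideanSpace ℝ (Fin n × Fin p))) P := by
  have hm : ∀ ij : Fin n × Fin p, AEMeasurable (fun ω => √n * Φ ω ij.1 ij.2) P := fun ij =>
    (hΦ.law ij.1 ij.2).aemeasurable.const_mul _
  have hentry : ∀ ij : Fin n × Fin p, P.map (fun ω => √n * Φ ω ij.1 ij.2) = gaussianReal 0 1 := by
    intro ij
    have h1 : P.map (fun ω => √n * Φ ω ij.1 ij.2)
        = (P.map (fun ω => Φ ω ij.1 ij.2)).map (fun x => √n * x) :=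
      (AEMeasurable.map_map_of_aemeasurable (by fun_prop) (hΦ.law ij.1 ij.2).aemeasurable).symm
    rw [h1, (hΦ.law ij.1 ij.2).map_eq, gaussianReal_map_const_mul, mul_zero]
    congr 1
    ext
    have : (n : ℝ) ≠ 0 := by positivity
    simp [Real.sq_sqrt, this]
  have hind : iIndepFun (fun (ij : Fin n × Fin p) ω => √n * Φ ω ij.1 ij.2) P :=
    hΦ.indep.comp (fun _ x => √n * x) fun _ => by fun_prop
  have hpi := (iIndepFun_iff_map_fun_eq_pi_map hm).1 hind
  simp only [hentry] at hpi
  have hmp : AEMeasurable (fun ω (ij : Fin n × Fin p) => √n * Φ ω ij.1 ij.2) P :=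
    aemeasurable_pi_lambda _ hm
  refine ⟨(by fun_prop : Measurable (WithLp.toLp 2 : (Fin n × Fin p → ℝ) → _)).comp_aemeasurable
    hmp, ?_⟩
  rw [← map_pi_eq_stdGaussian, ← hpi, AEMeasurable.map_map_of_aemeasurable (by fun_prop) hmp]
  rfl

/-- With high probability, a random Gaussian map has gain at least `ε` on a set of unit vectors. -/
theorem IsGaussianMap.exists_forall_le_norm (hΦ : IsGaussianMap P Φ) (hn : 0 < n)
    {S : Set (EuclideanSpace ℝ (Fin p))} (hS : S.Nonempty) (hS1 : S ⊆ Metric.sphere 0 1) {ε : ℝ}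
    (hε : 0 ≤ gaussianLength n - gaussianWidth S - √n * ε) :
    ∃ E : Set Ω, MeasurableSet E ∧
      (∀ ω ∈ E, ∀ z ∈ S, ε ≤ ‖Matrix.toEuclideanLin (Φ ω) z‖) ∧
      1 - Real.exp (-(1 / 2) * (gaussianLength n - gaussianWidth S - √n * ε) ^ 2) ≤ P.real E := by
  obtain ⟨E, hEm, hE, hprob⟩ := exists_forall_le_norm_matVec hS hS1 hε
  have hlaw := hΦ.hasLaw_scaledVec hn
  -- the entries of `Φ` are only almost everywhere measurable
  obtain ⟨E', hE'sub, hE'm, hE'eq⟩ :=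
    (hlaw.aemeasurable.nullMeasurableSet_preimage hEm).exists_measurable_subset_ae_eq
  refine ⟨E', hE'm, fun ω hω z hz => ?_, ?_⟩
  · have h := hE _ (hE'sub hω) z hz
    have hn' : 0 < √(n : ℝ) := Real.sqrt_pos.2 (by positivity)
    rw [matVec_scaledVec, norm_smul, Real.norm_of_nonneg hn'.le] at h
    exact le_of_mul_le_mul_left h hn'
  · rw [measureReal_congr hE'eq]
    exact hprob.trans_eq (hlaw.measureReal_eq hEm).symm

end GaussianMap

theorem sub_sub_sqrt_mul_nonneg {n l w ε : ℝ} (hl : 0 ≤ l) (hnl : n - 1 ≤ l ^ 2) (hε0 : 0 < ε)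
    (hε1 : ε < 1) (hn : (w ^ 2 + 3 / 2) / (1 - ε) ^ 2 ≤ n) : 0 ≤ l - w - √n * ε := by
  have h1 : 0 < (1 - ε) ^ 2 := pow_pos (by linarith) 2
  rw [div_le_iff₀ h1] at hn
  have hn0 : 0 ≤ n := by
    by_contra! h
    nlinarith [sq_nonneg w]
  set a := √n with ha
  have ha0 : 0 ≤ a := Real.sqrt_nonneg n
  have ha2 : a ^ 2 = n := Real.sq_sqrt hn0
  set s := a * (1 - ε) with hs
  have hs0 : 0 ≤ s := mul_nonneg ha0 (by linarith)
  have hsa : s ≤ a := mul_le_of_le_one_right ha0 (by linarith)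
  have hs2 : w ^ 2 + 3 / 2 ≤ s ^ 2 := by rw [hs, mul_pow, ha2]; exact hn
  have hn1 : 3 / 2 ≤ n := by nlinarith [sq_nonneg w]
  -- with `a = √n` and `s = √n (1 - ε)`, both `a - √(n - 1)` and `s - w` are compared with `3 / (4 a)`
  set b := √(n - 1) with hb
  have hb0 : 0 ≤ b := Real.sqrt_nonneg _
  have hb2 : b ^ 2 = n - 1 := Real.sq_sqrt (by linarith)
  have hbl : b ≤ l := Real.sqrt_le_iff.2 ⟨hl, hnl⟩
  have hws : w ≤ s := (le_abs_self w).trans (abs_le_of_sq_le_sq (by linarith) hs0)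
  have ha3 : a ≤ 3 * b := by
    refine (abs_le_of_sq_le_sq (a := a) ?_ (by positivity)).trans' (le_abs_self a)
    nlinarith
  have hba : b ≤ a := Real.sqrt_le_sqrt (by linarith)
  have ha1 : 0 < a := Real.sqrt_pos.2 (by linarith)
  have k1 : 3 / 2 ≤ (s - w) * (2 * a) := by nlinarith
  have k2 : (a - b) * (2 * a) ≤ 3 / 2 := by nlinarith
  have k3 : a - b ≤ s - w := le_of_mul_le_mul_right (k2.trans k1) (by linarith)
  have : s = a - a * ε := by rw [hs]; ring
  linarith

theorem corollary3p3 {n p : ℕ} (A : Set (EuclideanSpace ℝ (Fin p)))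
    (hA : IsCompact A) (hA0 : (0 : EuclideanSpace ℝ (Fin p)) ∈ convexHull ℝ A)
    (xstar : EuclideanSpace ℝ (Fin p)) (hx : IsAtomicCombination A xstar) (hx0 : xstar ≠ 0)
    {Ω : Type*} [MeasurableSpace Ω] (P : Measure Ω) [IsProbabilityMeasure P]
    (Φ : Ω → Matrix (Fin n) (Fin p) ℝ) (hΦ : IsGaussianMap P Φ) :
    (gaussianWidth (sphericalPart A xstar) ^ 2 + 1 ≤ (n : ℝ) →
      HoldsWithProbAtLeast P
        (1 - Real.exp (-(1 / 2 : ℝ) *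
          (gaussianLength n - gaussianWidth (sphericalPart A xstar)) ^ 2))
        (fun ω => ∀ x, SolvesExact A (Φ ω) (Matrix.toEuclideanLin (Φ ω) xstar) x ↔ x = xstar)) ∧
    (∀ ε δ : ℝ, 0 < ε → ε < 1 →
      (gaussianWidth (sphericalPart A xstar) ^ 2 + 3 / 2) / (1 - ε) ^ 2 ≤ (n : ℝ) →
      HoldsWithProbAtLeast P
        (1 - Real.exp (-(1 / 2 : ℝ) *
          (gaussianLength n - gaussianWidth (sphericalPart A xstar) - Real.sqrt n * ε) ^ 2))
        (fun ω => ∀ e : EuclideanSpace ℝ (Fin n), ‖e‖ ≤ δ →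
          (∃ xhat, SolvesNoisy A (Φ ω) (Matrix.toEuclideanLin (Φ ω) xstar + e) δ xhat) ∧
          ∀ xhat, SolvesNoisy A (Φ ω) (Matrix.toEuclideanLin (Φ ω) xstar + e) δ xhat →
            ‖xstar - xhat‖ ≤ 2 * δ / ε)) := by
  have hS := sphericalPart_nonempty hA0 hx0
  have hS1 : sphericalPart A xstar ⊆ Metric.sphere 0 1 := Set.inter_subset_right
  have hlen := sub_one_le_gaussianLength_sq n
  have hlen0 : 0 ≤ gaussianLength n := integral_nonneg fun g => norm_nonneg g
  set w := gaussianWidth (sphericalPart A xstar) with hw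
  set l := gaussianLength n with hl
  refine ⟨fun hn => ?_, fun ε δ hε0 hε1 hn => ?_⟩
  · have hn0 : 0 < n := by
      rw [← Nat.cast_pos (α := ℝ)]
      nlinarith [sq_nonneg w]
    have hwl : w ≤ l := (le_abs_self w).trans (abs_le_of_sq_le_sq (by linarith) hlen0)
    -- if `w = λₙ` then the asserted probability is zero
    rcases hwl.eq_or_lt with heq | hlt
    · exact ⟨∅, MeasurableSet.empty, fun ω hω => hω.elim, by simp [heq]⟩
    -- gains `ε > 0` of arbitrarily small size are covered by the events `E j`
    have hsn : 0 < √(n : ℝ) := Real.sqrt_pos.2 (by positivity)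
    have hE : ∀ j : ℕ, ∃ E : Set Ω, MeasurableSet E ∧
        (∀ ω ∈ E, ∀ z ∈ sphericalPart A xstar,
          (l - w) * (1 / ((j : ℝ) + 1)) / √n ≤ ‖Matrix.toEuclideanLin (Φ ω) z‖) ∧
        1 - Real.exp (-(1 / 2) * (l - w - (l - w) * (1 / ((j : ℝ) + 1))) ^ 2) ≤ P.real E := by
      intro j
      have hcancel : √n * ((l - w) * (1 / ((j : ℝ) + 1)) / √n) = (l - w) * (1 / ((j : ℝ) + 1)) :=
        mul_div_cancel₀ _ hsn.ne'
      have hj : (1 : ℝ) / ((j : ℝ) + 1) ≤ 1 := by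
        rw [div_le_one (by positivity)]
        linarith [(Nat.cast_nonneg j : (0 : ℝ) ≤ j)]
      have := hΦ.exists_forall_le_norm hn0 hS hS1
        (ε := (l - w) * (1 / ((j : ℝ) + 1)) / √n) (by rw [hcancel]; nlinarith)
      rwa [hcancel] at this
    choose E hEm hEz hEp using hE
    refine ⟨⋃ j, E j, MeasurableSet.iUnion hEm, fun ω hω x => ?_, ?_⟩
    · obtain ⟨j, hj⟩ := Set.mem_iUnion.1 hω
      exact solvesExact_iff (div_pos (mul_pos (sub_pos.2 hlt) (by positivity)) hsn) (hEz j ω hj) x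
    · have hlim : Filter.Tendsto (fun j : ℕ => 1 - Real.exp (-(1 / 2) *
          (l - w - (l - w) * (1 / ((j : ℝ) + 1))) ^ 2)) Filter.atTop
          (nhds (1 - Real.exp (-(1 / 2) * (l - w - (l - w) * 0) ^ 2))) :=
        tendsto_const_nhds.sub ((Real.continuous_exp.tendsto _).comp (((tendsto_const_nhds.sub
          (tendsto_one_div_add_atTop_nhds_zero_nat.const_mul _)).pow 2).const_mul _))
      rw [mul_zero, sub_zero] at hlim
      exact le_of_tendsto' hlim fun j =>
        (hEp j).trans (measureReal_mono (Set.subset_iUnion E j))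
  · have hn0 : 0 < n := by
      rw [← Nat.cast_pos (α := ℝ)]
      exact (div_pos (by positivity) (pow_pos (by linarith) 2)).trans_le hn
    obtain ⟨E, hEm, hEz, hEp⟩ := hΦ.exists_forall_le_norm hn0 hS hS1
      (sub_sub_sqrt_mul_nonneg hlen0 hlen hε0 hε1 hn)
    refine ⟨E, hEm, fun ω hω e he => ⟨?_, fun xhat hxhat => ?_⟩, hEp⟩
    · obtain ⟨t, ht, hxt⟩ := hx.exists_mem_smul hx0
      refine exists_isAtomicMinimizer hA hA0 ?_ (x := xstar) ?_ ht hxt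
      · refine isClosed_le (continuous_norm.comp (continuous_const.sub ?_)) continuous_const
        exact (Matrix.toEuclideanLin (Φ ω)).continuous_of_finiteDimensional
      · change ‖Matrix.toEuclideanLin (Φ ω) xstar + e - Matrix.toEuclideanLin (Φ ω) xstar‖ ≤ δ
        rwa [add_sub_cancel_left]
    · exact norm_sub_le_of_solvesNoisy hε0 (hEz ω hω) he hxhat
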